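/- Consider a single harmonic oscillator with Hilbert space $\mathcal H=\ell^2(\mathbb N_0)$, Fock basis $|n\rangle$, $a|n\rangle=\sqrt n\,|n-1\rangle$, and coherent states $|\alpha\rangle=e^{-|\alpha|^2/2}\sum_{n\ge 0}\frac{\alpha^n}{\sqrt{n!}}|n\rangle$, $\alpha\in\mathbb C$. Let $\mathcal C$ (the classical states) be the trace-norm closed convex hull of $\{|\alpha\rangle\langle\alpha| : \alpha\in\mathbb C\}$; states outside $\mathcal C$ are called nonclassical. For a density operator $\rho$ let $$R^s_{\mathcal C}(\rho)=\inf\Big\{1+\lambda \;:\; \lambda\ge 0,\ \exists\,\sigma\in\mathcal C,\ \tfrac{\rho+\lambda\sigma}{1+\lambda}\in\mathcal C\Big\}\in[1,\infty]$$ be the standard robustness of nonclassicality (with $\inf\emptyset=\infty$), and let $\chi_1^\rho(\alpha)=e^{|\alpha|^2/2}\,\mathrm{Tr}\big[\rho\, e^{\alpha a^\dagger-\alpha^* a}\big]$ be the normally ordered characteristic function, where the displacement operator $e^{\alpha a^\dagger-\alpha^* a}$ is a well-defined bounded operator and the trace converges. Then, for every density operator $\rho$, $$R^s_{\mathcal C}(\rho)\;\ge\;\tfrac12\Big(\sup_{\alpha\in\mathbb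 C}|\chi_1^\rho(\alpha)|+1\Big).$$ Consequently $R^s_{\mathcal C}(\rho)=\infty$ whenever $\chi_1^\rho$ is unbounded on $\mathbb C$. Moreover $\chi_1^\rho$ is unbounded, and hence $R^s_{\mathcal C}(\rho)=\infty$, in each of the following cases: 1. $\rho=|\psi\rangle\langle\psi|$ for a unit vector $\psi$ that is a finite superposition of Fock states with $\langle n|\psi\rangle\neq0$ for some $n\ge1$ (that is, not just the vacuum); 2. $\rho=|\zeta_r\rangle\langle\zeta_r|$ with the squeezed state $|\zeta_r\rangle=e^{r(a^2-a^{\dagger2})/2}|0\rangle$, $r\in\mathbb R$, $r\ne0$ (the vector $|\zeta_r\rangle$ being well defined); 3. $\rho$ is the pure state of a cat state $|\alpha_\pm\rangle\propto|\alpha\rangle\pm|-\alpha\rangle$ with $\alpha\in\mathbb C$, $\alpha\neq0$, for either sign; 4. $\rho$ is a Gaussian state, i.e. a density operator with $\mathrm{Tr}[\rho e^{\alpha a^\dagger-\alpha^*a}]=e^{i m(\alpha)-Q(\alpha)/2}$ for a real-linear functional $m$ and a real quadratic form $Q$ on $\mathbb C\cong\mathbb R^2$, and $\rho\notin\mathcal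 C$. -/

import Mathlib

namespace BosonicMode

open scoped ENNReal NNReal

noncomputable section

/-! ### The Hilbert space of one harmonic oscillator -/

/-- The Hilbert space of a single mode, in its Fock (number) representation `ℓ²(ℕ, ℂ)`. -/
abbrev FockSpace : Type := lp (fun _ : ℕ => ℂ) 2

/-- Bounded operators on the single-mode Hilbert space. -/
abbrev Op : Type := FockSpace →L[ℂ] FockSpace

/-- The Fock state vector `|n⟩`. -/
def fock (n : ℕ) : FockSpace := lp.single 2 n (1 : ℂ)

/-- The operator `|ψ⟩⟨ψ|`. -/
def proj (ψ : FockSpace) : Op := InnerProductSpace.rankOne ℂ ψ ψ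

/-- The Fock coefficients `e^{-|α|²/2} αⁿ / √(n!)` of the coherent state `|α⟩`. -/
def coherentCoeff (α : ℂ) (n : ℕ) : ℂ :=
  (Real.exp (-‖α‖ ^ 2 / 2) : ℂ) * (α ^ n / (Real.sqrt (n.factorial : ℝ) : ℂ))

theorem coherentCoeff_memℓp (α : ℂ) : Memℓp (coherentCoeff α) 2 := by
  apply memℓp_gen
  have h : Summable fun n : ℕ =>
      Real.exp (-‖α‖ ^ 2 / 2) ^ 2 * ((‖α‖ ^ 2) ^ n / (n.factorial : ℝ)) :=
    (Real.summable_pow_div_factorial (‖α‖ ^ 2)).mul_left _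
  refine h.congr fun n => ?_
  have hs : Real.sqrt (n.factorial : ℝ) ^ 2 = (n.factorial : ℝ) := Real.sq_sqrt (by positivity)
  have h2 : ((2 : ℝ≥0∞).toReal) = ((2 : ℕ) : ℝ) := by norm_num
  rw [h2, Real.rpow_natCast, coherentCoeff, norm_mul, norm_div, norm_pow, Complex.norm_real,
    Complex.norm_real, Real.norm_of_nonneg (Real.exp_pos _).le,
    Real.norm_of_nonneg (Real.sqrt_nonneg _), mul_pow, div_pow, hs, ← pow_mul, ← pow_mul,
    mul_comm n 2]

/-- The coherent state vector `|α⟩ = e^{-|α|²/2} ∑ₙ αⁿ / √(n!) |n⟩`. -/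
def coherent (α : ℂ) : FockSpace := ⟨coherentCoeff α, coherentCoeff_memℓp α⟩

/-! ### Trace, density operators, trace norm -/

/-- The trace `∑ₙ ⟨n|T|n⟩` (of a trace class operator). -/
def tr (T : Op) : ℂ := ∑' n, inner ℂ (fock n) (T (fock n))

/-- Density operators: positive operators of trace one. -/
def IsDensity (ρ : Op) : Prop :=
  ρ.IsPositive ∧ HasSum (fun n => inner ℂ (fock n) (ρ (fock n))) (1 : ℂ)

/-- The trace norm, `‖T‖₁ = sup ∑ᵢ |⟨fᵢ, T gᵢ⟩|` over all finite orthonormal systems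
`(fᵢ)`, `(gᵢ)`; it is `∞` when `T` is not trace class. -/
def traceNorm (T : Op) : ℝ≥0∞ :=
  ⨆ (N : ℕ) (f : Fin N → FockSpace) (g : Fin N → FockSpace)
    (_ : Orthonormal ℂ f) (_ : Orthonormal ℂ g), ∑ i, ‖inner ℂ (f i) (T (g i))‖ₑ

/-- The trace-norm closure of a set of operators. -/
def traceClosure (S : Set Op) : Set Op :=
  {T | ∀ ε : ℝ≥0∞, 0 < ε → ∃ σ ∈ S, traceNorm (T - σ) < ε}

/-! ### Standard robustness and classical states -/

/-- The standard robustness of `ρ` relative to a set `F` of free states: the infimum in `[0, ∞]`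
(so `∞` if there is no feasible point) of `1 + l` over all real `l ≥ 0` such that
`(ρ + l σ) / (1 + l) ∈ F` for some `σ ∈ F`. -/
def standardRobustness (F : Set Op) (ρ : Op) : ℝ≥0∞ :=
  ⨅ (l : ℝ≥0) (_ : ∃ σ ∈ F, (1 + (l : ℝ))⁻¹ • (ρ + (l : ℝ) • σ) ∈ F), (1 + (l : ℝ≥0∞))

/-- The classical states: the trace-norm closed convex hull of the coherent states. -/
def classicalStates : Set Op :=
  traceClosure (convexHull ℝ (Set.range fun α : ℂ => proj (coherent α)))

/-! ### Ladder operators and exponentials -/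

/-- The annihilation operator acting on Fock coefficients, `(a f)ₙ = √(n+1) fₙ₊₁`. -/
def annihilation : Module.End ℂ (ℕ → ℂ) where
  toFun f n := (Real.sqrt ((n : ℝ) + 1) : ℂ) * f (n + 1)
  map_add' f g := by ext n; simp [mul_add]
  map_smul' c f := by ext n; simp [mul_left_comm]

/-- The creation operator acting on Fock coefficients, `(a† f)ₙ = √n fₙ₋₁`
(which is `0` for `n = 0`). -/
def creation : Module.End ℂ (ℕ → ℂ) where
  toFun f n := (Real.sqrt (n : ℝ) : ℂ) * f (n - 1)
  map_add' f g := by ext n; simp [mul_add]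
  map_smul' c f := by ext n; simp [mul_left_comm]

/-- `u` solves `u'(t) = A u(t)` for all real `t`, with the derivative taken in Hilbert space norm.
Here `A` is an expression in the ladder operators, taken on its maximal domain: those `ψ` in the
Fock space for which the coefficient sequence `A ψ` is again square-summable. -/
def IsOrbit (A : Module.End ℂ (ℕ → ℂ)) (u : ℝ → FockSpace) : Prop :=
  ∀ t : ℝ, ∃ v : FockSpace, (v : ℕ → ℂ) = A (u t : ℕ → ℂ) ∧ HasDerivAt u v t

/-- `ζ = e^A ψ`: the vector `ζ` is the value at time `1` of the solution of `u' = A u`, `u(0) = ψ`.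
For the skew-adjoint generators used below this is the action of the unitary `e^A`. -/
def IsExpVec (A : Module.End ℂ (ℕ → ℂ)) (ψ ζ : FockSpace) : Prop :=
  ∃ u : ℝ → FockSpace, IsOrbit A u ∧ u 0 = ψ ∧ u 1 = ζ

/-- `E = e^A` for a bounded operator `E`: it acts as `e^A` on every Fock vector. -/
def IsExpOp (A : Module.End ℂ (ℕ → ℂ)) (E : Op) : Prop :=
  ∀ n : ℕ, IsExpVec A (fock n) (E (fock n))

/-- The generator `α a† - α* a` of phase-space displacements. -/
def displacementGenerator (α : ℂ) : Module.End ℂ (ℕ → ℂ) :=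
  α • creation - (starRingEnd ℂ α) • annihilation

/-- The displacement operator `e^{α a† - α* a}`. -/
def displacement (α : ℂ) : Op := Classical.epsilon (IsExpOp (displacementGenerator α))

/-- The squeezing generator `r (a² - a†²) / 2`. -/
def squeezingGenerator (r : ℝ) : Module.End ℂ (ℕ → ℂ) :=
  ((r : ℂ) / 2) • (annihilation ^ 2 - creation ^ 2)

/-- The squeezed state vector `|ζ_r⟩ = e^{r (a² - a†²) / 2} |0⟩`. -/
def squeezed (r : ℝ) : FockSpace :=
  Classical.epsilon (IsExpVec (squeezingGenerator r) (fock 0))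

/-- The unnormalised cat state vector `|α⟩ + s |-α⟩`, for a sign `s`. -/
def catAux (s : ℤˣ) (α : ℂ) : FockSpace := coherent α + ((s : ℤ) : ℂ) • coherent (-α)

/-- The Schrödinger cat state vector, `|α⟩ ± |-α⟩` divided by its norm. -/
def cat (s : ℤˣ) (α : ℂ) : FockSpace := ((‖catAux s α‖ : ℂ)⁻¹) • catAux s α

/-! ### Characteristic functions and Gaussian states -/

/-- The (symmetrically ordered) characteristic function `Tr[ρ e^{α a† - α* a}]`. -/
def chi (ρ : Op) (α : ℂ) : ℂ := tr (ρ ∘L displacement α)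

/-- The normally ordered characteristic function `e^{|α|²/2} Tr[ρ e^{α a† - α* a}]`. -/
def chiNormal (ρ : Op) (α : ℂ) : ℂ := (Real.exp (‖α‖ ^ 2 / 2) : ℂ) * chi ρ α

/-- The normally ordered characteristic function is unbounded. -/
def UnboundedChi (ρ : Op) : Prop := ¬ BddAbove (Set.range fun α : ℂ => ‖chiNormal ρ α‖)

/-- Gaussian states: density operators whose characteristic function is a Gaussian on phase space,
`exp(i m(α) - Q(α) / 2)` with `m` real-linear and `Q` a real quadratic form in `α`. -/
def IsGaussian (ρ : Op) : Prop :=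
  IsDensity ρ ∧ ∃ (m : ℂ →ₗ[ℝ] ℝ) (Q : QuadraticForm ℝ ℂ),
    ∀ α : ℂ, chi ρ α = Complex.exp (Complex.I * (m α : ℂ) - (Q α : ℂ) / 2)

/-- The standard robustness of nonclassicality. -/
def nonclassicalityRobustness (ρ : Op) : ℝ≥0∞ := standardRobustness classicalStates ρ

end

end BosonicMode

open BosonicMode

namespace BosonicMode

open scoped ENNReal NNReal ComplexConjugate
open Filter Topology MeasureTheory ProbabilityTheory

noncomputable section

/-! ### The Fock basis -/

/-! The bound rests on one fact: for a coherent state the normally ordered characteristic function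
has modulus 1 everywhere. It is linear in the operator and, at each fixed α, continuous in trace
norm, so its modulus is at most 1 on all classical states. If (ρ + λσ)/(1 + λ) = τ with σ, τ
classical, then ρ = (1 + λ)τ − λσ, whence |χ₁^ρ| ≤ 1 + 2λ; this rearranges to the bound
(`norm_chiNormal_le_of_feasible`).

The exponentials are defined through differential equations on maximal domains, so existence and
uniqueness must be proved. Fock vectors are analytic vectors of the skew-symmetric band generators,
which yields solutions by exponential series. Pairing an arbitrary solution with such a series
solution gives a constant inner product (`inner_const`); this yields both uniqueness and isometry.
The displacement is then computed on exponential vectors ∑ βⁿ/√n! |n⟩, and in the Bargmann picture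
e^{|α|²/2} D(α) is multiplication by e^{αw} after translation by α* (`bargmann_normalDisp`).

Unboundedness for pure states is read off along one line in phase space. A finite superposition with
top level N gives a polynomial of degree 2N; a cat state has a cross term growing exponentially; for
a squeezed vacuum every Fock contribution is nonnegative on a suitable axis and the vacuum
contribution alone grows like a Gaussian.

For Gaussian states the contrapositive is proved. Boundedness forces Q(α) ≥ |α|², so Q − |α|² is a
sum of two squares of linear forms, and the same characteristic function is realised by coherent
states with a normally distributed amplitude. That mixture is classical
(`mixture_mem_classicalStates`), and a trace class operator is determined by its characteristic
function (`eq_zero_of_chi_eq_zero`), so ρ itself is classical. -/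

theorem fock_apply (n m : ℕ) : (fock n : ℕ → ℂ) m = if m = n then 1 else 0 := by
  rw [fock, lp.single_apply]
  by_cases h : m = n
  · subst h; simp
  · simp [h]

theorem inner_fock_left (n : ℕ) (f : FockSpace) : inner ℂ (fock n) f = f n := by
  rw [fock, lp.inner_single_left]; simp

theorem inner_fock_right (n : ℕ) (f : FockSpace) : inner ℂ f (fock n) = conj (f n) := by
  rw [← inner_conj_symm, inner_fock_left]

theorem orthonormal_fock : Orthonormal ℂ fock := by
  rw [orthonormal_iff_ite]
  intro i j
  rw [inner_fock_left, fock_apply]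

theorem norm_fock (n : ℕ) : ‖fock n‖ = 1 := orthonormal_fock.1 n

theorem hasSum_fock (f : FockSpace) : HasSum (fun n => f n • fock n) f := by
  have h := lp.hasSum_single (p := 2) (by norm_num) f
  convert h using 2 with n
  rw [fock, ← lp.single_smul]; simp

theorem hasSum_inner_fock (x y : FockSpace) :
    HasSum (fun n => inner ℂ x (fock n) * inner ℂ (fock n) y) (inner ℂ x y) := by
  have e : (fun n => inner ℂ x (fock n) * inner ℂ (fock n) y) =
      fun n => (inner ℂ (x n) (y n) : ℂ) := by
    funext n
    rw [inner_fock_left, inner_fock_right]; simp [mul_comm]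
  rw [e]
  exact lp.hasSum_inner x y

theorem dense_span_fock : Dense (Submodule.span ℂ (Set.range fock) : Set FockSpace) := by
  intro f
  refine mem_closure_of_tendsto (hasSum_fock f) (Eventually.of_forall fun s => ?_)
  exact Submodule.sum_mem _ fun n _ => Submodule.smul_mem _ _ (Submodule.subset_span ⟨n, rfl⟩)

theorem ext_fock {x y : FockSpace} (h : ∀ n, inner ℂ (fock n) x = inner ℂ (fock n) y) : x = y := by
  ext n
  rw [← inner_fock_left, h, inner_fock_left]

/-! ### Vector-valued power series -/

section PowerSeries

variable {E : Type*} [NormedAddCommGroup E] [NormedSpace ℂ E] [CompleteSpace E]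

/-- The sum of the power series with vector coefficients `x k`. -/
def powerVec (x : ℕ → E) (z : ℂ) : E := ∑' k, z ^ k • x k

theorem hasSum_powerVec {x : ℕ → E} {C K : ℝ} (hK : 0 ≤ K) (hx : ∀ k, ‖x k‖ ≤ C * K ^ k) {z : ℂ}
    (hz : K * ‖z‖ < 1) : HasSum (fun k => z ^ k • x k) (powerVec x z) := by
  apply Summable.hasSum
  refine Summable.of_norm_bounded
    ((summable_geometric_of_lt_one (by positivity) hz).mul_left C) fun k => ?_
  rw [norm_smul, norm_pow, mul_pow]
  calc ‖z‖ ^ k * ‖x k‖ ≤ ‖z‖ ^ k * (C * K ^ k) := by gcongr; exact hx k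
    _ = _ := by ring

/-- Termwise differentiation on a ball of radius r with ‖z‖ < r < 1/K. The derived series is
reindexed so that, when `x k` is Aᵏ|n⟩/k!, its terms are A applied to those of the original series.
-/
theorem hasDerivAt_powerVec {x : ℕ → E} {C K : ℝ} (hK : 0 < K) (hx : ∀ k, ‖x k‖ ≤ C * K ^ k)
    {z : ℂ} (hz : K * ‖z‖ < 1) :
    ∃ v, HasSum (fun k : ℕ => z ^ k • ((k + 1 : ℂ) • x (k + 1))) v ∧
      HasDerivAt (powerVec x) v z := by
  obtain ⟨r, hzr, hr⟩ : ∃ r, ‖z‖ < r ∧ r < 1 / K := exists_between ((lt_div_iff₀' hK).2 hz)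
  have hr0 : 0 < r := (norm_nonneg _).trans_lt hzr
  have hKr : K * r < 1 := by
    exact (lt_div_iff₀' hK).1 hr
  have hC : 0 ≤ C := by simpa using (norm_nonneg _).trans (hx 0)
  have hu : Summable fun k : ℕ => C * K * ((k : ℝ) * (K * r) ^ (k - 1)) := by
    refine Summable.mul_left _ ?_
    rw [← summable_nat_add_iff 1]
    have h1 := summable_pow_mul_geometric_of_norm_lt_one 1 (r := K * r)
      (by rwa [Real.norm_of_nonneg (by positivity)])
    have h0 := summable_geometric_of_lt_one (by positivity) hKr
    refine (h1.add h0).congr fun k => ?_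
    simp; ring
  have hb : ∀ (k : ℕ) (y : ℂ), y ∈ Metric.ball (0 : ℂ) r →
      ‖((k : ℂ) * y ^ (k - 1)) • x k‖ ≤ C * K * ((k : ℝ) * (K * r) ^ (k - 1)) := by
    intro k y hy
    rw [norm_smul, norm_mul, norm_pow, Complex.norm_natCast]
    rcases k with _ | k
    · simp
    · have hy' : ‖y‖ ≤ r := by simpa using (Metric.mem_ball.1 hy).le
      calc ((k + 1 : ℕ) : ℝ) * ‖y‖ ^ (k + 1 - 1) * ‖x (k + 1)‖
          ≤ ((k + 1 : ℕ) : ℝ) * r ^ (k + 1 - 1) * (C * K ^ (k + 1)) := by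
            gcongr; exact hx _
        _ = _ := by rw [Nat.add_sub_cancel]; ring
  have hzm : z ∈ Metric.ball (0 : ℂ) r := by simpa using hzr
  have hd := hasDerivAt_tsum_of_isPreconnected (𝕜 := ℂ) (g := fun k y => y ^ k • x k) hu
    Metric.isOpen_ball (convex_ball (0 : ℂ) r).isPreconnected
    (fun k y _ => (hasDerivAt_pow k y).smul_const (x k)) hb hzm
    (hasSum_powerVec hK.le hx hz).summable hzm
  refine ⟨_, ?_, hd⟩
  have hs : HasSum (fun k : ℕ => ((k : ℂ) * z ^ (k - 1)) • x k) _ :=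
    (Summable.of_norm_bounded hu fun k => hb k z hzm).hasSum
  rw [← hasSum_nat_add_iff' 1] at hs
  simp only [Finset.range_one, Finset.sum_singleton, Nat.cast_zero, zero_mul, zero_smul,
    sub_zero] at hs
  convert hs using 2 with k
  simp [smul_smul, mul_comm]

end PowerSeries

/-! ### Evolution generated by skew-symmetric ladder operators -/

/-- `p` lies in the domain of the negative adjoint of the maximal operator `A`, which maps
`p` to `q`. -/
def CoreAct (A : Module.End ℂ (ℕ → ℂ)) (p q : FockSpace) : Prop :=
  ∀ y y' : FockSpace, (y' : ℕ → ℂ) = A (y : ℕ → ℂ) → inner ℂ y' p = - inner ℂ y q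

namespace CoreAct

variable {A : Module.End ℂ (ℕ → ℂ)}

theorem smul {p q : FockSpace} (c : ℂ) (h : CoreAct A p q) : CoreAct A (c • p) (c • q) :=
  fun y y' e => by rw [inner_smul_right, inner_smul_right, h y y' e]; ring

theorem sum {ι : Type*} (s : Finset ι) {p q : ι → FockSpace} (h : ∀ i, CoreAct A (p i) (q i)) :
    CoreAct A (∑ i ∈ s, p i) (∑ i ∈ s, q i) := fun y y' e => by
  rw [inner_sum, inner_sum, ← Finset.sum_neg_distrib]
  exact Finset.sum_congr rfl fun i _ => h i y y' e

/-- The relation is an adjoint pairing, hence has closed graph: infinite sums pass through although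
A is unbounded. -/
theorem hasSum {ι : Type*} {p q : ι → FockSpace} {P Q : FockSpace} (hp : HasSum p P)
    (hq : HasSum q Q) (h : ∀ i, CoreAct A (p i) (q i)) : CoreAct A P Q := fun y y' e => by
  have h1 := hp.mapL (innerSL ℂ y')
  have h2 := (hq.mapL (innerSL ℂ y)).neg
  have e' : (fun i => innerSL ℂ y' (p i)) = fun i => -innerSL ℂ y (q i) :=
    funext fun i => h i y y' e
  rw [e'] at h1
  exact h1.unique h2

end CoreAct

/-- `A` is a skew-symmetric operator of finite band width, with `A |n⟩ = W n`. -/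
structure IsSkewLadder (A : Module.End ℂ (ℕ → ℂ)) (W : ℕ → FockSpace) : Prop where
  coe_eq : ∀ n, (W n : ℕ → ℂ) = A (fock n : ℕ → ℂ)
  skew : ∀ (y : FockSpace) (n : ℕ), A (y : ℕ → ℂ) n = - inner ℂ (W n) y

namespace IsSkewLadder

variable {A : Module.End ℂ (ℕ → ℂ)} {W : ℕ → FockSpace}

theorem coreAct_fock (h : IsSkewLadder A W) (n : ℕ) : CoreAct A (fock n) (W n) := by
  intro y y' e
  rw [inner_fock_right, e, h.skew, map_neg, inner_conj_symm]

theorem coe_of_coreAct (h : IsSkewLadder A W) {p q : FockSpace} (hpq : CoreAct A p q) :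
    (q : ℕ → ℂ) = A (p : ℕ → ℂ) := by
  ext n
  rw [h.skew, hpq _ _ (h.coe_eq n), neg_neg, inner_fock_left]

end IsSkewLadder

/-- `u` solves `u' = A u` at time `t` inside the domain described by `CoreAct`. -/
def CoreDeriv (A : Module.End ℂ (ℕ → ℂ)) (v : ℝ → FockSpace) (t : ℝ) : Prop :=
  ∃ v', HasDerivAt v v' t ∧ CoreAct A (v t) v'

/-- `u` solves `u' = A u` at time `t`, with `A` taken on its maximal domain. -/
def MaxDeriv (A : Module.End ℂ (ℕ → ℂ)) (u : ℝ → FockSpace) (t : ℝ) : Prop :=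
  ∃ v' : FockSpace, (v' : ℕ → ℂ) = A (u t : ℕ → ℂ) ∧ HasDerivAt u v' t

theorem CoreDeriv.maxDeriv {A : Module.End ℂ (ℕ → ℂ)} {W : ℕ → FockSpace} (h : IsSkewLadder A W)
    {v : ℝ → FockSpace} {t : ℝ} (hv : CoreDeriv A v t) : MaxDeriv A v t := by
  obtain ⟨v', h1, h2⟩ := hv
  exact ⟨v', h.coe_of_coreAct h2, h1⟩

/-- The two terms of the product rule cancel by `CoreAct`. Only one factor has to lie in the smaller
domain; this asymmetry is what later gives uniqueness among all maximal-domain solutions. -/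
theorem hasDerivAt_inner_eq_zero {A : Module.End ℂ (ℕ → ℂ)} {u v : ℝ → FockSpace} {t : ℝ}
    (hu : MaxDeriv A u t) (hv : CoreDeriv A v t) :
    HasDerivAt (fun s => inner ℂ (u s) (v s)) 0 t := by
  obtain ⟨u', hu1, hu2⟩ := hu
  obtain ⟨v', hv1, hv2⟩ := hv
  have := hu2.inner ℂ hv1
  rwa [hv2 _ _ hu1, add_neg_cancel] at this

theorem inner_const {A : Module.End ℂ (ℕ → ℂ)} {u v : ℝ → FockSpace} {S : Set ℝ} (hS : IsOpen S)
    (hS' : IsPreconnected S) (hu : ∀ t ∈ S, MaxDeriv A u t) (hv : ∀ t ∈ S, CoreDeriv A v t)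
    {s t : ℝ} (hs : s ∈ S) (ht : t ∈ S) : inner ℂ (u s) (v s) = inner ℂ (u t) (v t) := by
  have hd := fun r hr => hasDerivAt_inner_eq_zero (hu r hr) (hv r hr)
  exact hS.is_const_of_deriv_eq_zero (f := fun s => inner ℂ (u s) (v s)) hS'
    (fun r hr => (hd r hr).differentiableAt.differentiableWithinAt) (fun r hr => (hd r hr).deriv)
    hs ht

/-- The zero set of u is clopen. Series solutions are needed only for times below δ, because the
squeezing series is controlled only on a short interval; what matters is that δ does not depend on
n. -/
theorem eq_zero_of_orbit {A : Module.End ℂ (ℕ → ℂ)} {δ : ℝ} (hδ : 0 < δ)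
    (hloc : ∀ n, ∃ v : ℝ → FockSpace, v 0 = fock n ∧ ∀ t, |t| < δ → CoreDeriv A v t)
    {u : ℝ → FockSpace} (hu : IsOrbit A u) (h0 : u 0 = 0) (t : ℝ) : u t = 0 := by
  have hcont : Continuous u := continuous_iff_continuousAt.2 fun t => by
    obtain ⟨v, _, hv⟩ := hu t
    exact hv.continuousAt
  have hcl : IsClopen {t | u t = 0} := by
    refine ⟨isClosed_eq hcont continuous_const, Metric.isOpen_iff.2 fun t0 ht0 => ⟨δ, hδ, ?_⟩⟩
    intro s hs
    refine ext_fock fun n => ?_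
    -- The solution is restarted at time s from |n⟩. Pairing it with u carries the n-th coefficient
    -- of `u s` to a pairing with `u t0`, which is 0.
    obtain ⟨v, hv0, hv⟩ := hloc n
    have hvs : ∀ t ∈ Metric.ball s δ, CoreDeriv A (fun τ => v (τ - s)) t := by
      intro t ht
      obtain ⟨v', h1, h2⟩ := hv (t - s) (by simpa [Real.dist_eq] using ht)
      exact ⟨v', h1.comp_sub_const t s, h2⟩
    have := inner_const Metric.isOpen_ball (convex_ball s δ).isPreconnected
      (fun t _ => hu t) hvs (Metric.mem_ball_self hδ) (by rwa [Metric.mem_ball_comm] :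
        t0 ∈ Metric.ball s δ)
    have ht0' : u t0 = 0 := ht0
    rw [ht0', inner_zero_left, sub_self, hv0] at this
    rw [← inner_conj_symm, this]; simp
  have ht : t ∈ {t | u t = 0} := by
    rw [hcl.eq_univ ⟨0, h0⟩]; exact Set.mem_univ t
  exact ht

theorem orbit_unique {A : Module.End ℂ (ℕ → ℂ)} {δ : ℝ} (hδ : 0 < δ)
    (hloc : ∀ n, ∃ v : ℝ → FockSpace, v 0 = fock n ∧ ∀ t, |t| < δ → CoreDeriv A v t)
    {u₁ u₂ : ℝ → FockSpace} (hu₁ : IsOrbit A u₁) (hu₂ : IsOrbit A u₂) (h0 : u₁ 0 = u₂ 0) (t : ℝ) :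
    u₁ t = u₂ t := by
  rw [← sub_eq_zero]
  refine eq_zero_of_orbit (u := fun t => u₁ t - u₂ t) hδ hloc (fun t => ?_) (by simp [h0]) t
  obtain ⟨v₁, e₁, h₁⟩ := hu₁ t
  obtain ⟨v₂, e₂, h₂⟩ := hu₂ t
  refine ⟨v₁ - v₂, ?_, h₁.sub h₂⟩
  rw [lp.coeFn_sub, lp.coeFn_sub, map_sub, e₁, e₂]

/-! ### Analytic vectors -/

/-- `v` is supported in `{0, …, N}` and its coefficients have `ℓ¹` norm at most `c`. -/
def FinBound (N : ℕ) (c : ℝ) (v : FockSpace) : Prop :=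
  (∀ m, N < m → v m = 0) ∧ ∑ m ∈ Finset.range (N + 1), ‖v m‖ ≤ c

namespace FinBound

theorem eq_sum {N : ℕ} {c : ℝ} {v : FockSpace} (h : FinBound N c v) :
    v = ∑ m ∈ Finset.range (N + 1), v m • fock m := by
  refine (hasSum_fock v).unique (hasSum_sum_of_ne_finset_zero fun m hm => ?_)
  rw [h.1 m (by simpa using hm), zero_smul]

theorem norm_le {N : ℕ} {c : ℝ} {v : FockSpace} (h : FinBound N c v) : ‖v‖ ≤ c := by
  rw [h.eq_sum]
  refine (norm_sum_le _ _).trans ((Finset.sum_le_sum fun m _ => ?_).trans h.2)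
  rw [norm_smul, norm_fock, mul_one]

theorem mono {N N' : ℕ} {c c' : ℝ} {v : FockSpace} (h : FinBound N c v) (hN : N ≤ N')
    (hc : c ≤ c') : FinBound N' c' v := by
  refine ⟨fun m hm => h.1 m (hN.trans_lt hm), (le_of_eq ?_).trans (h.2.trans hc)⟩
  symm
  refine Finset.sum_subset (Finset.range_mono (by omega)) fun m _ hm => ?_
  rw [h.1 m (by simpa using hm), norm_zero]

theorem add {N : ℕ} {c c' : ℝ} {v v' : FockSpace} (h : FinBound N c v) (h' : FinBound N c' v') :
    FinBound N (c + c') (v + v') := by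
  refine ⟨fun m hm => by simp [h.1 m hm, h'.1 m hm], ?_⟩
  calc ∑ m ∈ Finset.range (N + 1), ‖(v + v' : FockSpace) m‖
      ≤ ∑ m ∈ Finset.range (N + 1), (‖v m‖ + ‖v' m‖) :=
        Finset.sum_le_sum fun m _ => norm_add_le _ _
    _ ≤ c + c' := by rw [Finset.sum_add_distrib]; exact add_le_add h.2 h'.2

theorem smul {N : ℕ} {c : ℝ} {v : FockSpace} (a : ℂ) (h : FinBound N c v) :
    FinBound N (‖a‖ * c) (a • v) := by
  refine ⟨fun m hm => by simp [h.1 m hm], ?_⟩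
  calc ∑ m ∈ Finset.range (N + 1), ‖(a • v : FockSpace) m‖
      = ‖a‖ * ∑ m ∈ Finset.range (N + 1), ‖v m‖ := by
        rw [Finset.mul_sum]; exact Finset.sum_congr rfl fun m _ => norm_smul a (v m)
    _ ≤ _ := by gcongr; exact h.2

theorem zero (N : ℕ) : FinBound N 0 0 := ⟨fun m _ => by simp, by simp⟩

theorem sum {ι : Type*} (s : Finset ι) {N : ℕ} {c : ι → ℝ} {v : ι → FockSpace}
    (h : ∀ i ∈ s, FinBound N (c i) (v i)) : FinBound N (∑ i ∈ s, c i) (∑ i ∈ s, v i) := by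
  classical
  induction s using Finset.induction_on with
  | empty => simpa using zero N
  | insert a s ha ih =>
    rw [Finset.sum_insert ha, Finset.sum_insert ha]
    exact (h a (by simp)).add (ih fun i hi => h i (by simp [hi]))

theorem fock (n : ℕ) : FinBound n 1 (fock n) := by
  refine ⟨fun m hm => by simp [fock_apply, hm.ne'], ?_⟩
  simp [fock_apply, apply_ite]

end FinBound

/-- The iterates `A^k |n⟩`, for an operator with `A |m⟩ = W m` of band width `d`. -/
def iterVec (W : ℕ → FockSpace) (d n : ℕ) : ℕ → FockSpace
  | 0 => fock n
  | k + 1 => ∑ m ∈ Finset.range (n + d * k + 1), (iterVec W d n k) m • W m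

/-- Each application of A widens the support by d and multiplies the ℓ¹ norm by at most the weight
at the current top level, as w is monotone. -/
theorem finBound_iterVec {W : ℕ → FockSpace} {d : ℕ} {w : ℕ → ℝ} (hw : Monotone w)
    (hw0 : ∀ n, 0 ≤ w n)
    (hW : ∀ m, FinBound (m + d) (w m) (W m)) (n k : ℕ) :
    FinBound (n + d * k) (∏ j ∈ Finset.range k, w (n + d * j)) (iterVec W d n k) := by
  induction k with
  | zero => simpa [iterVec] using FinBound.fock n
  | succ k ih =>
    have := FinBound.sum (Finset.range (n + d * k + 1)) (N := n + d * (k + 1))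
      (c := fun m => ‖(iterVec W d n k) m‖ * w (n + d * k))
      (v := fun m => (iterVec W d n k) m • W m) fun m hm => by
        have hm' : m ≤ n + d * k := by simpa [Nat.lt_succ_iff] using hm
        exact ((hW m).mono (by rw [mul_add]; omega) (hw hm')).smul _
    refine this.mono le_rfl ?_
    rw [← Finset.sum_mul, Finset.prod_range_succ]
    exact mul_le_mul_of_nonneg_right ih.2 (hw0 _)

theorem coreAct_iterVec {A : Module.End ℂ (ℕ → ℂ)} {W : ℕ → FockSpace} (h : IsSkewLadder A W)
    {d : ℕ} {w : ℕ → ℝ} (hw : Monotone w) (hw0 : ∀ n, 0 ≤ w n)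
    (hW : ∀ m, FinBound (m + d) (w m) (W m)) (n k : ℕ) :
    CoreAct A (iterVec W d n k) (iterVec W d n (k + 1)) := by
  have := CoreAct.sum (A := A) (Finset.range (n + d * k + 1)) fun m =>
    (h.coreAct_fock m).smul ((iterVec W d n k) m)
  rwa [← (finBound_iterVec hw hw0 hW n k).eq_sum] at this

/-- The solution of `u' = A u`, `u 0 = |n⟩` given by the exponential series. -/
def expOrbit (W : ℕ → FockSpace) (d n : ℕ) (t : ℝ) : FockSpace :=
  powerVec (fun k => (k.factorial : ℂ)⁻¹ • iterVec W d n k) (t : ℂ)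

theorem expOrbit_zero (W : ℕ → FockSpace) (d n : ℕ) : expOrbit W d n 0 = fock n := by
  rw [expOrbit, powerVec, tsum_eq_single 0]
  · simp [iterVec]
  · intro k hk; simp [hk]

/-- The product of weights bounds ‖Aᵏ|n⟩‖; growth at most C Kᵏ k! means that |n⟩ is an analytic
vector and the exponential series converges for |t| < 1/K. -/
theorem coreDeriv_expOrbit {A : Module.End ℂ (ℕ → ℂ)} {W : ℕ → FockSpace} (h : IsSkewLadder A W)
    {d : ℕ} {w : ℕ → ℝ} (hw : Monotone w) (hw0 : ∀ n, 0 ≤ w n)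
    (hW : ∀ m, FinBound (m + d) (w m) (W m)) {n : ℕ} {C K : ℝ} (hK : 0 < K)
    (hC : ∀ k, ∏ j ∈ Finset.range k, w (n + d * j) ≤ C * K ^ k * k.factorial) {t : ℝ}
    (ht : K * |t| < 1) : CoreDeriv A (expOrbit W d n) t := by
  have hx : ∀ k, ‖(k.factorial : ℂ)⁻¹ • iterVec W d n k‖ ≤ C * K ^ k := by
    intro k
    have hf : (0 : ℝ) < k.factorial := by positivity
    rw [norm_smul, norm_inv, Complex.norm_natCast, inv_mul_le_iff₀ hf, mul_comm (k.factorial : ℝ)]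
    exact (finBound_iterVec hw hw0 hW n k).norm_le.trans (hC k)
  have hz : K * ‖(t : ℂ)‖ < 1 := by simpa using ht
  obtain ⟨v, hv, hd⟩ := hasDerivAt_powerVec hK hx hz
  refine ⟨v, ?_, CoreAct.hasSum (hasSum_powerVec hK.le hx hz) hv fun k => ?_⟩
  · have h1 := hd.scomp t Complex.ofRealCLM.hasDerivAt
    rw [Complex.ofRealCLM_apply, Complex.ofReal_one, one_smul] at h1
    exact h1
  · convert ((coreAct_iterVec h hw hw0 hW n k).smul ((k.factorial : ℂ)⁻¹)).smul ((t : ℂ) ^ k) using 2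
    rw [smul_smul, Nat.factorial_succ]
    congr 1
    have : (k + 1 : ℂ) ≠ 0 := by exact_mod_cast Nat.succ_ne_zero k
    have : (k.factorial : ℂ) ≠ 0 := by exact_mod_cast k.factorial_ne_zero
    push_cast
    field_simp

/-! ### The displacement generator -/

/-- The vector `(α a† - α* a) |n⟩`. -/
def displacementW (α : ℂ) (n : ℕ) : FockSpace :=
  (α * (Real.sqrt ((n : ℝ) + 1) : ℂ)) • fock (n + 1) -
    (conj α * (Real.sqrt (n : ℝ) : ℂ)) • fock (n - 1)

theorem displacementGenerator_apply (α : ℂ) (f : ℕ → ℂ) (n : ℕ) :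
    displacementGenerator α f n = α * ((Real.sqrt (n : ℝ) : ℂ) * f (n - 1)) -
      conj α * ((Real.sqrt ((n : ℝ) + 1) : ℂ) * f (n + 1)) := rfl

theorem isSkewLadder_displacement (α : ℂ) :
    IsSkewLadder (displacementGenerator α) (displacementW α) where
  coe_eq n := by
    ext m
    rw [displacementGenerator_apply, displacementW, lp.coeFn_sub, lp.coeFn_smul, lp.coeFn_smul]
    simp only [Pi.sub_apply, Pi.smul_apply, fock_apply, smul_eq_mul]
    congr 1
    · rcases m with _ | m
      · simp
      · by_cases h : m = n
        · subst h; simp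
        · simp [h]
    · rcases n with _ | n
      · simp
      · by_cases h : m = n
        · subst h; simp
        · simp [h]
  skew y n := by
    rw [displacementGenerator_apply, displacementW, inner_sub_left, inner_smul_left,
      inner_smul_left, inner_fock_left, inner_fock_left]
    simp only [map_mul, Complex.conj_ofReal, Complex.conj_conj]
    ring

theorem finBound_displacementW (α : ℂ) (n : ℕ) :
    FinBound (n + 1) (2 * ‖α‖ * Real.sqrt ((n : ℝ) + 1)) (displacementW α n) := by
  have h1 := (FinBound.fock (n + 1)).smul (α * (Real.sqrt ((n : ℝ) + 1) : ℂ))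
  have h2 := ((FinBound.fock (n - 1)).mono (by omega : n - 1 ≤ n + 1) le_rfl).smul
    (-(conj α * (Real.sqrt (n : ℝ) : ℂ)))
  have := h1.add h2
  rw [neg_smul, ← sub_eq_add_neg] at this
  refine this.mono le_rfl ?_
  rw [norm_neg, norm_mul, norm_mul, RCLike.norm_conj, Complex.norm_real, Complex.norm_real,
    Real.norm_of_nonneg (Real.sqrt_nonneg _), Real.norm_of_nonneg (Real.sqrt_nonneg _)]
  have : Real.sqrt (n : ℝ) ≤ Real.sqrt ((n : ℝ) + 1) := Real.sqrt_le_sqrt (by linarith)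
  nlinarith [norm_nonneg α, mul_le_mul_of_nonneg_left this (norm_nonneg α)]

/-- The ratio of the product to Kᵏ k! is nonincreasing once the hypothesis holds, so the sum of its
first values, a finite number of them, is a valid constant. -/
theorem exists_prod_le_factorial {w : ℕ → ℝ} {K : ℝ} (hK : 0 < K) (hw0 : ∀ j, 0 ≤ w j)
    (h : ∀ᶠ j : ℕ in atTop, w j ≤ K * (j + 1)) :
    ∃ C, ∀ k, ∏ j ∈ Finset.range k, w j ≤ C * K ^ k * k.factorial := by
  obtain ⟨j₀, hj⟩ := eventually_atTop.1 h
  set b : ℕ → ℝ := fun k => (∏ j ∈ Finset.range k, w j) / (K ^ k * k.factorial) with hb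
  have hb0 : ∀ k, 0 ≤ b k := fun k =>
    div_nonneg (Finset.prod_nonneg fun j _ => hw0 j) (by positivity)
  have hstep : ∀ k, j₀ ≤ k → b (k + 1) ≤ b k := by
    intro k hk
    rw [hb]
    dsimp only
    rw [div_le_div_iff₀ (by positivity) (by positivity), Finset.prod_range_succ,
      Nat.factorial_succ, pow_succ]
    have hp : 0 ≤ (∏ j ∈ Finset.range k, w j) * (K ^ k * k.factorial) :=
      mul_nonneg (Finset.prod_nonneg fun j _ => hw0 j) (by positivity)
    have := mul_le_mul_of_nonneg_left (hj k hk) hp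
    push_cast
    linarith
  refine ⟨∑ k ∈ Finset.range (j₀ + 1), b k, fun k => ?_⟩
  have hbk : b k ≤ ∑ k ∈ Finset.range (j₀ + 1), b k := by
    induction k with
    | zero => exact Finset.single_le_sum (fun i _ => hb0 i) (by simp)
    | succ k ih =>
      by_cases hk : j₀ ≤ k
      · exact (hstep k hk).trans ih
      · exact Finset.single_le_sum (f := b) (fun i _ => hb0 i)
          (Finset.mem_range.2 (by omega))
  have hpos : 0 < K ^ k * (k.factorial : ℝ) := by positivity
  rw [hb] at hbk
  dsimp only at hbk
  rw [mul_assoc]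
  exact (div_le_iff₀ hpos).1 hbk

theorem coreDeriv_displacement (α : ℂ) (n : ℕ) (t : ℝ) :
    CoreDeriv (displacementGenerator α) (expOrbit (displacementW α) 1 n) t := by
  -- The weights grow only like √j, which is below any linear rate. So K may be as small as t
  -- requires, and the series converges at all times.
  set K : ℝ := (|t| + 1)⁻¹ with hKdef
  have hK : 0 < K := by positivity
  have hKt : K * |t| < 1 := by
    rw [hKdef, inv_mul_lt_iff₀ (by positivity)]; linarith
  set w : ℕ → ℝ := fun n => 2 * ‖α‖ * Real.sqrt ((n : ℝ) + 1) with hw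
  have hmono : Monotone w := fun a b hab => by
    have : (a : ℝ) ≤ b := by exact_mod_cast hab
    rw [hw]; dsimp only; gcongr
  have hw0 : ∀ n, 0 ≤ w n := fun n => by positivity
  obtain ⟨C, hC⟩ := exists_prod_le_factorial (w := fun j => w (n + 1 * j)) hK
    (fun j => hw0 _) (by
      have ht : Tendsto (fun j : ℕ => K * Real.sqrt ((j : ℝ) + 1)) atTop atTop :=
        (Real.tendsto_sqrt_atTop.comp
          (tendsto_atTop_add_const_right _ 1 tendsto_natCast_atTop_atTop)).const_mul_atTop hK
      filter_upwards [ht.eventually_ge_atTop (2 * ‖α‖ * Real.sqrt ((n : ℝ) + 1))] with j hj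
      have h1 : Real.sqrt (((n + 1 * j : ℕ) : ℝ) + 1) ≤
          Real.sqrt ((n : ℝ) + 1) * Real.sqrt ((j : ℝ) + 1) := by
        rw [← Real.sqrt_mul (by positivity)]
        refine Real.sqrt_le_sqrt ?_
        push_cast
        nlinarith [mul_nonneg (Nat.cast_nonneg (α := ℝ) n) (Nat.cast_nonneg (α := ℝ) j)]
      calc 2 * ‖α‖ * Real.sqrt (((n + 1 * j : ℕ) : ℝ) + 1)
          ≤ 2 * ‖α‖ * (Real.sqrt ((n : ℝ) + 1) * Real.sqrt ((j : ℝ) + 1)) := by gcongr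
        _ = (2 * ‖α‖ * Real.sqrt ((n : ℝ) + 1)) * Real.sqrt ((j : ℝ) + 1) := by ring
        _ ≤ (K * Real.sqrt ((j : ℝ) + 1)) * Real.sqrt ((j : ℝ) + 1) := by gcongr
        _ = K * (j + 1) := by rw [mul_assoc, Real.mul_self_sqrt (by positivity)])
  exact coreDeriv_expOrbit (isSkewLadder_displacement α) hmono hw0 (finBound_displacementW α) hK
    hC hKt

/-! ### The displacement operator -/

/-- Inner products of two series orbits are conserved, so they keep their values at time 0. -/
theorem orthonormal_expOrbit_displacement (α : ℂ) (t : ℝ) :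
    Orthonormal ℂ fun n => expOrbit (displacementW α) 1 n t := by
  rw [orthonormal_iff_ite]
  intro i j
  rw [inner_const isOpen_univ isPreconnected_univ
    (fun s _ => (coreDeriv_displacement α i s).maxDeriv (isSkewLadder_displacement α))
    (fun s _ => coreDeriv_displacement α j s) (Set.mem_univ t) (Set.mem_univ 0),
    expOrbit_zero, expOrbit_zero, inner_fock_left, fock_apply]

/-- The displacement operator as an isometry. -/
def displacementIsometry (α : ℂ) : FockSpace →ₗᵢ[ℂ] FockSpace :=
  (orthonormal_expOrbit_displacement α 1).orthogonalFamily.linearIsometry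

theorem displacementIsometry_fock (α : ℂ) (n : ℕ) :
    displacementIsometry α (fock n) = expOrbit (displacementW α) 1 n 1 := by
  rw [displacementIsometry, fock, OrthogonalFamily.linearIsometry_apply_single]
  simp

theorem isExpOp_displacementIsometry (α : ℂ) :
    IsExpOp (displacementGenerator α) (displacementIsometry α).toContinuousLinearMap := fun n =>
  ⟨expOrbit (displacementW α) 1 n,
    fun t => (coreDeriv_displacement α n t).maxDeriv (isSkewLadder_displacement α),
    expOrbit_zero _ _ _, (displacementIsometry_fock α n).symm⟩

theorem isExpOp_displacement_unique {α : ℂ} {D D' : Op} (h : IsExpOp (displacementGenerator α) D)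
    (h' : IsExpOp (displacementGenerator α) D') : D = D' := by
  refine ContinuousLinearMap.ext_on dense_span_fock ?_
  rintro _ ⟨n, rfl⟩
  obtain ⟨u, hu, hu0, hu1⟩ := h n
  obtain ⟨u', hu', hu0', hu1'⟩ := h' n
  rw [← hu1, ← hu1']
  exact orbit_unique one_pos (fun n => ⟨_, expOrbit_zero _ _ n,
    fun t _ => coreDeriv_displacement α n t⟩) hu hu' (hu0.trans hu0'.symm) 1

theorem displacement_eq (α : ℂ) :
    displacement α = (displacementIsometry α).toContinuousLinearMap :=
  isExpOp_displacement_unique (Classical.epsilon_spec ⟨_, isExpOp_displacementIsometry α⟩)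
    (isExpOp_displacementIsometry α)

theorem norm_displacement_apply (α : ℂ) (x : FockSpace) : ‖displacement α x‖ = ‖x‖ := by
  rw [displacement_eq]; exact (displacementIsometry α).norm_map x

theorem orthonormal_displacement_fock (α : ℂ) :
    Orthonormal ℂ fun n => displacement α (fock n) := by
  rw [displacement_eq]
  exact orthonormal_fock.comp_linearIsometry (displacementIsometry α)

/-! ### Exponential vectors -/

/-- The unnormalised coherent state vector `∑ₙ βⁿ / √(n!) |n⟩`. -/
def expVec (β : ℂ) : FockSpace :=
  powerVec (fun n => ((Real.sqrt (n.factorial : ℝ))⁻¹ : ℂ) • fock n) β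

/-- This is xⁿ/n! ≤ eˣ at x = K⁻². Since every K > 0 is allowed, the power series is entire. -/
theorem norm_expVec_coeff_le {K : ℝ} (hK : 0 < K) (n : ℕ) :
    ‖((Real.sqrt (n.factorial : ℝ))⁻¹ : ℂ) • fock n‖ ≤ Real.sqrt (Real.exp ((K ^ 2)⁻¹)) * K ^ n := by
  rw [norm_smul, norm_fock, mul_one, norm_inv, Complex.norm_real,
    Real.norm_of_nonneg (Real.sqrt_nonneg _)]
  have h := Real.pow_div_factorial_le_exp ((K ^ 2)⁻¹) (by positivity) n
  have hf : (0 : ℝ) < n.factorial := by positivity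
  rw [inv_le_iff_one_le_mul₀ (by positivity), ← Real.sqrt_sq (by positivity : 0 ≤ K ^ n),
    ← Real.sqrt_mul (by positivity), ← Real.sqrt_mul (by positivity)]
  rw [div_le_iff₀ hf, inv_pow, ← pow_mul, mul_comm 2 n, pow_mul,
    inv_le_iff_one_le_mul₀ (by positivity)] at h
  exact Real.one_le_sqrt.2 (h.trans_eq (by ring))

theorem exists_rate (β : ℂ) : ∃ K : ℝ, 0 < K ∧ K * ‖β‖ < 1 :=
  ⟨(‖β‖ + 1)⁻¹, by positivity, by rw [inv_mul_lt_iff₀ (by positivity)]; linarith⟩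

theorem hasSum_expVec (β : ℂ) :
    HasSum (fun n => β ^ n • ((Real.sqrt (n.factorial : ℝ))⁻¹ : ℂ) • fock n) (expVec β) := by
  obtain ⟨K, hK, hKβ⟩ := exists_rate β
  exact hasSum_powerVec hK.le (norm_expVec_coeff_le hK) hKβ

theorem expVec_apply (β : ℂ) (n : ℕ) :
    expVec β n = β ^ n / (Real.sqrt (n.factorial : ℝ) : ℂ) := by
  have h := (hasSum_expVec β).mapL (innerSL ℂ (fock n))
  have h' := hasSum_single (f := fun m => innerSL ℂ (fock n)
    (β ^ m • ((Real.sqrt (m.factorial : ℝ))⁻¹ : ℂ) • fock m)) n fun m hm => by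
      simp [inner_fock_left, fock_apply, hm.symm]
  have := h.unique h'
  rw [innerSL_apply_apply, inner_fock_left] at this
  rw [this, innerSL_apply_apply, inner_smul_right, inner_smul_right, inner_fock_left, fock_apply,
    if_pos rfl, mul_one, div_eq_mul_inv]

theorem inner_expVec_left (β : ℂ) (f : FockSpace) :
    HasSum (fun n => (conj β) ^ n * (f n / (Real.sqrt (n.factorial : ℝ) : ℂ)))
      (inner ℂ (expVec β) f) := by
  have h := hasSum_inner_fock (expVec β) f
  have e : (fun n => (conj β) ^ n * (f n / (Real.sqrt (n.factorial : ℝ) : ℂ))) =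
      fun n => inner ℂ (expVec β) (fock n) * inner ℂ (fock n) f := by
    funext n
    rw [inner_fock_right, inner_fock_left, expVec_apply]
    simp only [map_div₀, map_pow, Complex.conj_ofReal]
    ring
  rwa [e]

theorem sqrt_factorial_mul_self (n : ℕ) :
    (Real.sqrt (n.factorial : ℝ) : ℂ) * (Real.sqrt (n.factorial : ℝ) : ℂ) = n.factorial := by
  rw [← Complex.ofReal_mul, Real.mul_self_sqrt (by positivity), Complex.ofReal_natCast]

theorem sqrt_factorial_ne_zero (n : ℕ) : (Real.sqrt (n.factorial : ℝ) : ℂ) ≠ 0 := by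
  have : Real.sqrt (n.factorial : ℝ) ≠ 0 := by positivity
  exact_mod_cast this

theorem inner_expVec_expVec (β γ : ℂ) :
    inner ℂ (expVec β) (expVec γ) = Complex.exp (conj β * γ) := by
  refine (inner_expVec_left β (expVec γ)).unique ?_
  have h := NormedSpace.expSeries_div_hasSum_exp (conj β * γ)
  rw [← Complex.exp_eq_exp_ℂ] at h
  have e : (fun n => (conj β) ^ n * (expVec γ n / (Real.sqrt (n.factorial : ℝ) : ℂ))) =
      fun n : ℕ => (conj β * γ) ^ n / (n.factorial : ℂ) := by
    funext n
    rw [expVec_apply, div_div, sqrt_factorial_mul_self, mul_pow, mul_div_assoc]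
  rwa [e]

theorem coherent_eq (α : ℂ) : coherent α = Complex.exp (-(conj α * α) / 2) • expVec α := by
  ext n
  rw [lp.coeFn_smul, Pi.smul_apply, expVec_apply, smul_eq_mul]
  change coherentCoeff α n = _
  rw [coherentCoeff, Complex.ofReal_exp, Complex.conj_mul']
  push_cast
  rfl

theorem exists_hasDerivAt_expVec (β : ℂ) : ∃ v : FockSpace, HasDerivAt expVec v β ∧
    ∀ n : ℕ, v n = n * β ^ (n - 1) / (Real.sqrt (n.factorial : ℝ) : ℂ) := by
  obtain ⟨K, hK, hKβ⟩ := exists_rate β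
  obtain ⟨v, -, hv⟩ := hasDerivAt_powerVec hK (norm_expVec_coeff_le hK) hKβ
  refine ⟨v, hv, fun n => ?_⟩
  have h1 := (innerSL ℂ (fock n)).hasFDerivAt.comp_hasDerivAt β hv
  have h2 : HasDerivAt (fun β : ℂ => β ^ n / (Real.sqrt (n.factorial : ℝ) : ℂ)) _ β :=
    (hasDerivAt_pow n β).div_const _
  have e : (innerSL ℂ (fock n)) ∘ expVec =
      fun β : ℂ => β ^ n / (Real.sqrt (n.factorial : ℝ) : ℂ) := by
    funext γ
    rw [Function.comp_apply, innerSL_apply_apply, inner_fock_left, expVec_apply]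
  rw [← e] at h2
  have := h1.unique h2
  rwa [innerSL_apply_apply, inner_fock_left] at this

/-- An explicit orbit through an exponential vector E(γ). On exponential vectors a acts as
multiplication by β (`h1` below) and a† as d/dβ (`h2`); the scalar prefactor absorbs the remaining
multiple of E(γ + tα). -/
theorem maxDeriv_expVec (α γ : ℂ) (t : ℝ) :
    MaxDeriv (displacementGenerator α) (fun t : ℝ =>
      Complex.exp (-(t * (conj α * γ)) - t ^ 2 * (conj α * α) / 2) • expVec (γ + t * α)) t := by
  obtain ⟨v, hv, hvn⟩ := exists_hasDerivAt_expVec (γ + t * α)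
  have hof : HasDerivAt (fun t : ℝ => (t : ℂ)) 1 t := Complex.ofRealCLM.hasDerivAt
  have hβ : HasDerivAt (fun t : ℝ => γ + t * α) α t := by
    simpa using (hof.mul_const α).const_add γ
  have hE : HasDerivAt (fun t : ℝ => expVec (γ + t * α)) (α • v) t := hv.scomp t hβ
  have hc : HasDerivAt (fun t : ℝ => Complex.exp (-(t * (conj α * γ)) - t ^ 2 * (conj α * α) / 2))
      (Complex.exp (-(t * (conj α * γ)) - t ^ 2 * (conj α * α) / 2) *
        (-(conj α * (γ + t * α)))) t := by
    have h2 : HasDerivAt (fun t : ℝ => (t : ℂ) ^ 2) (2 * t) t := by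
      have := hof.fun_pow 2
      rwa [Nat.cast_ofNat, mul_one, pow_one] at this
    have h3 := ((hof.mul_const (conj α * γ)).fun_neg.fun_sub
      ((h2.mul_const (conj α * α)).div_const 2)).cexp
    convert h3 using 1
    ring
  refine ⟨_, ?_, hc.smul hE⟩
  ext n
  rw [displacementGenerator_apply]
  simp only [lp.coeFn_add, lp.coeFn_smul, Pi.add_apply, Pi.smul_apply, smul_eq_mul, hvn,
    expVec_apply]
  set c := Complex.exp (-(t * (conj α * γ)) - t ^ 2 * (conj α * α) / 2)
  set β := γ + t * α
  have h1 : (Real.sqrt ((n : ℝ) + 1) : ℂ) *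
      (β ^ (n + 1) / (Real.sqrt ((n + 1).factorial : ℝ) : ℂ)) =
      β * (β ^ n / (Real.sqrt (n.factorial : ℝ) : ℂ)) := by
    rw [Nat.factorial_succ, Nat.cast_mul, Real.sqrt_mul (by positivity)]
    have h0 : (Real.sqrt ((n : ℝ) + 1) : ℂ) ≠ 0 := by
      have : Real.sqrt ((n : ℝ) + 1) ≠ 0 := by positivity
      exact_mod_cast this
    have h0' := sqrt_factorial_ne_zero n
    push_cast
    field_simp
    ring
  have h2 : (n : ℂ) * β ^ (n - 1) / (Real.sqrt (n.factorial : ℝ) : ℂ) =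
      (Real.sqrt (n : ℝ) : ℂ) * (β ^ (n - 1) / (Real.sqrt ((n - 1).factorial : ℝ) : ℂ)) := by
    rcases n with _ | n
    · simp
    · rw [Nat.factorial_succ, Nat.cast_mul, Real.sqrt_mul (by positivity), Nat.add_sub_cancel]
      have h0 : (Real.sqrt ((n + 1 : ℕ) : ℝ) : ℂ) ≠ 0 := by
        have : Real.sqrt ((n + 1 : ℕ) : ℝ) ≠ 0 := by positivity
        exact_mod_cast this
      have h0' := sqrt_factorial_ne_zero n
      have h3 : ((n + 1 : ℕ) : ℂ) =
          (Real.sqrt ((n + 1 : ℕ) : ℝ) : ℂ) * (Real.sqrt ((n + 1 : ℕ) : ℝ) : ℂ) := by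
        rw [← Complex.ofReal_mul, Real.mul_self_sqrt (by positivity), Complex.ofReal_natCast]
      rw [h3, Complex.ofReal_mul]
      field_simp
  rw [h2]
  linear_combination (conj α * c) * h1

/-- The defining property of the displacement concerns Fock vectors only. Conservation of the
pairing between the explicit orbit and the orbit of |n⟩ therefore yields first the adjoint,
coefficient by coefficient. -/
theorem adjoint_displacement_expVec (α γ : ℂ) : (displacement α).adjoint
    (Complex.exp (-(conj α * γ) - (conj α * α) / 2) • expVec (γ + α)) = expVec γ := by
  refine ext_fock fun n => ?_
  rw [ContinuousLinearMap.adjoint_inner_right, displacement_eq]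
  have h := inner_const isOpen_univ isPreconnected_univ (fun s _ => maxDeriv_expVec α γ s)
    (fun s _ => coreDeriv_displacement α n s) (Set.mem_univ 1) (Set.mem_univ 0)
  have h' : displacementIsometry α (fock n) = _ := displacementIsometry_fock α n
  rw [LinearIsometry.coe_toContinuousLinearMap, h', ← inner_conj_symm,
    ← inner_conj_symm (fock n), ← expOrbit_zero (displacementW α) 1 n]
  refine congrArg conj ?_
  simpa only [Complex.ofReal_one, Complex.ofReal_zero, one_mul, one_pow, zero_mul, neg_zero,
    zero_div, sub_zero, Complex.exp_zero, one_smul, add_zero, ne_eq, OfNat.ofNat_ne_zero,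
    not_false_eq_true, zero_pow] using h

/-- From the adjoint to the operator itself by the equality case of Cauchy–Schwarz: `D E(γ)` and x
have equal norms and inner product equal to that norm squared, so their difference has norm 0. -/
theorem displacement_expVec (α γ : ℂ) : displacement α (expVec γ) =
    Complex.exp (-(conj α * γ) - (conj α * α) / 2) • expVec (γ + α) := by
  set x := Complex.exp (-(conj α * γ) - (conj α * α) / 2) • expVec (γ + α) with hx
  have hn : ‖x‖ = ‖expVec γ‖ := by
    have h : inner ℂ x x = inner ℂ (expVec γ) (expVec γ) := by
      rw [hx, inner_smul_left, inner_smul_right, inner_expVec_expVec, inner_expVec_expVec,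
        ← Complex.exp_conj, ← Complex.exp_add, ← Complex.exp_add]
      congr 1
      simp only [map_sub, map_neg, map_mul, map_div₀, Complex.conj_conj, map_add, map_ofNat]
      ring
    rw [inner_self_eq_norm_sq_to_K, inner_self_eq_norm_sq_to_K] at h
    have h' : ‖x‖ ^ 2 = ‖expVec γ‖ ^ 2 := by exact_mod_cast h
    exact (pow_left_inj₀ (norm_nonneg _) (norm_nonneg _) two_ne_zero).1 h'
  have hi : inner ℂ (displacement α (expVec γ)) x = inner ℂ (expVec γ) (expVec γ) := by
    rw [← ContinuousLinearMap.adjoint_inner_right, adjoint_displacement_expVec]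
  rw [← sub_eq_zero, ← norm_eq_zero, ← sq_eq_zero_iff, norm_sub_sq (𝕜 := ℂ), hi,
    norm_displacement_apply, hn, inner_self_eq_norm_sq_to_K]
  norm_cast
  ring

/-! ### Entire power series -/

/-- Evaluation at 0 kills the constant term; differentiation gives another vanishing series with
shifted coefficients, and the induction continues. -/
theorem coeff_eq_zero_of_hasSum_zero {a : ℕ → ℂ} (h : ∀ w : ℂ, HasSum (fun n => w ^ n * a n) 0)
    (n : ℕ) : a n = 0 := by
  induction n generalizing a with
  | zero =>
    have h0 := (h 0).unique (hasSum_single 0 fun n hn => by simp [hn])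
    simpa using h0.symm
  | succ n ih =>
    have h' : ∀ w : ℂ, HasSum (fun n : ℕ => w ^ n * ((n + 1 : ℂ) * a (n + 1))) 0 := by
      intro w
      obtain ⟨K, hK, hKw⟩ := exists_rate w
      -- Convergence at the point 1/K bounds the terms there, which is the required geometric bound
      -- on the coefficients.
      obtain ⟨C, hC⟩ : ∃ C, ∀ k, ‖a k‖ ≤ C * K ^ k := by
        obtain ⟨C, hC⟩ := (h ((K⁻¹ : ℝ) : ℂ)).summable.tendsto_atTop_zero.norm.bddAbove_range
        refine ⟨C, fun k => ?_⟩
        have := hC ⟨k, rfl⟩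
        dsimp only at this
        rwa [norm_mul, norm_pow, Complex.norm_real, Real.norm_of_nonneg (by positivity), inv_pow,
          inv_mul_le_iff₀ (by positivity), mul_comm] at this
      obtain ⟨v, hv, hd⟩ := hasDerivAt_powerVec hK hC hKw
      have hz : powerVec a = fun _ => 0 := by
        funext z
        exact (h z).tsum_eq
      rw [hz] at hd
      rw [hd.unique (hasDerivAt_const w (0 : ℂ))] at hv
      exact hv
    have := ih h'
    have hn : (n + 1 : ℂ) ≠ 0 := by exact_mod_cast Nat.succ_ne_zero n
    exact (mul_eq_zero.1 this).resolve_left hn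

theorem coeff_unique {a b : ℕ → ℂ} {F : ℂ → ℂ} (ha : ∀ w : ℂ, HasSum (fun n => w ^ n * a n) (F w))
    (hb : ∀ w : ℂ, HasSum (fun n => w ^ n * b n) (F w)) (n : ℕ) : a n = b n := by
  rw [← sub_eq_zero]
  refine coeff_eq_zero_of_hasSum_zero (a := fun n => a n - b n) (fun w => ?_) n
  simpa [mul_sub] using (ha w).sub (hb w)

theorem eq_of_inner_expVec {x y : FockSpace}
    (h : ∀ β, inner ℂ (expVec β) x = inner ℂ (expVec β) y) : x = y := by
  ext n
  have h1 : ∀ w : ℂ, HasSum (fun n => w ^ n * (x n / (Real.sqrt (n.factorial : ℝ) : ℂ)))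
      (inner ℂ (expVec (conj w)) x) := fun w => by
    simpa using inner_expVec_left (conj w) x
  have h2 : ∀ w : ℂ, HasSum (fun n => w ^ n * (y n / (Real.sqrt (n.factorial : ℝ) : ℂ)))
      (inner ℂ (expVec (conj w)) x) := fun w => by
    simpa [h] using inner_expVec_left (conj w) y
  have := coeff_unique h1 h2 n
  exact (div_left_inj' (sqrt_factorial_ne_zero n)).1 this

theorem dense_span_expVec : Dense (Submodule.span ℂ (Set.range expVec) : Set FockSpace) := by
  rw [Submodule.dense_iff_topologicalClosure_eq_top, Submodule.topologicalClosure_eq_top_iff,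
    Submodule.eq_bot_iff]
  intro x hx
  refine eq_of_inner_expVec fun β => ?_
  rw [inner_zero_right]
  exact (Submodule.mem_orthogonal _ _).1 hx _ (Submodule.subset_span ⟨β, rfl⟩)

/-! ### The trace norm -/

theorem sum_le_traceNorm {ι : Type*} [Fintype ι] (T : Op) {f g : ι → FockSpace}
    (hf : Orthonormal ℂ f) (hg : Orthonormal ℂ g) : ∑ i, ‖inner ℂ (f i) (T (g i))‖ₑ ≤ traceNorm T := by
  rw [← (Fintype.equivFin ι).symm.sum_comp]
  exact le_iSup_of_le (Fintype.card ι) <| le_iSup_of_le (f ∘ (Fintype.equivFin ι).symm) <|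
    le_iSup_of_le (g ∘ (Fintype.equivFin ι).symm) <|
    le_iSup_of_le (hf.comp _ (Equiv.injective _)) <|
    le_iSup_of_le (hg.comp _ (Equiv.injective _)) le_rfl

theorem traceNorm_le {T : Op} {C : ℝ≥0∞} (h : ∀ (N : ℕ) (f g : Fin N → FockSpace),
    Orthonormal ℂ f → Orthonormal ℂ g → ∑ i, ‖inner ℂ (f i) (T (g i))‖ₑ ≤ C) : traceNorm T ≤ C :=
  iSup_le fun N => iSup_le fun f => iSup_le fun g => iSup_le fun hf => iSup_le fun hg => h N f g hf hg

theorem traceNorm_le_ofReal {T : Op} {C : ℝ} (h : ∀ (N : ℕ) (f g : Fin N → FockSpace),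
    Orthonormal ℂ f → Orthonormal ℂ g → ∑ i, ‖inner ℂ (f i) (T (g i))‖ ≤ C) :
    traceNorm T ≤ ENNReal.ofReal C := by
  refine traceNorm_le fun N f g hf hg => ?_
  simp_rw [← ofReal_norm]
  rw [← ENNReal.ofReal_sum_of_nonneg fun _ _ => norm_nonneg _]
  exact ENNReal.ofReal_le_ofReal (h N f g hf hg)

theorem traceNorm_add_le (T S : Op) : traceNorm (T + S) ≤ traceNorm T + traceNorm S := by
  refine traceNorm_le fun N f g hf hg => ?_
  refine le_trans ?_ (add_le_add (sum_le_traceNorm T hf hg) (sum_le_traceNorm S hf hg))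
  rw [← Finset.sum_add_distrib]
  refine Finset.sum_le_sum fun i _ => ?_
  rw [_root_.add_apply, inner_add_right]
  exact enorm_add_le _ _

theorem traceNorm_smul_le (c : ℝ) (T : Op) : traceNorm (c • T) ≤ ‖c‖ₑ * traceNorm T := by
  refine traceNorm_le fun N f g hf hg => ?_
  refine le_trans (le_of_eq ?_) (mul_le_mul_right (sum_le_traceNorm T hf hg) _)
  rw [Finset.mul_sum]
  refine Finset.sum_congr rfl fun i _ => ?_
  rw [_root_.smul_apply, inner_smul_right_eq_smul, enorm_smul]

theorem traceNorm_sub_ne_top {T S : Op} (hT : traceNorm T ≠ ⊤) (hS : traceNorm S ≠ ⊤) :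
    traceNorm (T - S) ≠ ⊤ := by
  have h : T - S = T + (-1 : ℝ) • S := by rw [neg_one_smul, sub_eq_add_neg]
  rw [h]
  refine ne_top_of_le_ne_top (ENNReal.add_ne_top.2 ⟨hT, ?_⟩) (traceNorm_add_le _ _)
  exact ne_top_of_le_ne_top (ENNReal.mul_ne_top (by simp) hS) (traceNorm_smul_le _ _)

/-- Cauchy–Schwarz and Bessel for the images of two orthonormal systems. -/
theorem sum_inner_mul_le {ι : Type*} [Fintype ι] {f g : ι → FockSpace} (hf : Orthonormal ℂ f)
    (hg : Orthonormal ℂ g) (x y : FockSpace) :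
    ∑ i, ‖inner ℂ (f i) x‖ * ‖inner ℂ (g i) y‖ ≤ ‖x‖ * ‖y‖ := by
  have h := Finset.sum_mul_sq_le_sq_mul_sq Finset.univ (fun i => ‖inner ℂ (f i) x‖)
    (fun i => ‖inner ℂ (g i) y‖)
  have h1 : ∑ i, ‖inner ℂ (f i) x‖ ^ 2 ≤ ‖x‖ ^ 2 := hf.sum_inner_products_le x
  have h2 : ∑ i, ‖inner ℂ (g i) y‖ ^ 2 ≤ ‖y‖ ^ 2 := hg.sum_inner_products_le y
  refine le_of_abs_le (abs_le_of_sq_le_sq (h.trans ?_) (by positivity))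
  rw [mul_pow]
  gcongr

theorem traceNorm_rankOne_le (x y : FockSpace) :
    traceNorm (InnerProductSpace.rankOne ℂ x y) ≤ ENNReal.ofReal (‖x‖ * ‖y‖) := by
  refine traceNorm_le_ofReal fun N f g hf hg => ?_
  refine le_trans (le_of_eq (Finset.sum_congr rfl fun i _ => ?_)) (sum_inner_mul_le hf hg x y)
  rw [InnerProductSpace.inner_right_rankOne_apply, norm_mul, norm_inner_symm y]

theorem proj_sub_proj (x y : FockSpace) : proj x - proj y =
    InnerProductSpace.rankOne ℂ (x - y) x + InnerProductSpace.rankOne ℂ y (x - y) := by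
  simp only [proj, map_sub, _root_.sub_apply]
  abel

theorem traceNorm_proj_sub_le (x y : FockSpace) :
    traceNorm (proj x - proj y) ≤ ENNReal.ofReal (‖x - y‖ * (‖x‖ + ‖y‖)) := by
  rw [proj_sub_proj, mul_add, ENNReal.ofReal_add (by positivity) (by positivity)]
  refine (traceNorm_add_le _ _).trans (add_le_add (traceNorm_rankOne_le _ _) ?_)
  rw [mul_comm]
  exact traceNorm_rankOne_le _ _

/-- The Hilbert–Schmidt norm does not depend on the basis: expand ‖A fᵢ‖² in the Fock basis, move A
across, and apply Bessel's inequality over i for each n. -/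
theorem sum_norm_sq_apply_le {A : Op} (hA : IsSelfAdjoint A) {C : ℝ}
    (hC : HasSum (fun n => ‖A (fock n)‖ ^ 2) C) {ι : Type*} [Fintype ι] {f : ι → FockSpace}
    (hf : Orthonormal ℂ f) : ∑ i, ‖A (f i)‖ ^ 2 ≤ C := by
  have key : ∀ x : FockSpace, HasSum (fun n => ‖inner ℂ x (A (fock n))‖ ^ 2) (‖A x‖ ^ 2) := by
    intro x
    have h := (hasSum_inner_fock (A x) (A x)).mapL Complex.reCLM
    have e : (fun n => ‖inner ℂ x (A (fock n))‖ ^ 2) = fun n =>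
        Complex.reCLM (inner ℂ (A x) (fock n) * inner ℂ (fock n) (A x)) := by
      funext n
      have h1 : inner ℂ (A x) (fock n) = inner ℂ x (A (fock n)) := by
        rw [← ContinuousLinearMap.adjoint_inner_right, hA.adjoint_eq]
      rw [← inner_conj_symm (fock n), h1, Complex.mul_conj']
      norm_cast
    rw [e]
    convert h using 1
    rw [inner_self_eq_norm_sq_to_K]
    norm_cast
  have hs := hasSum_sum (s := Finset.univ) fun i _ => key (f i)
  exact hasSum_le (fun n => hf.sum_inner_products_le (A (fock n))) hs hC

theorem exists_selfAdjoint_mul_self {H : Type*} [NormedAddCommGroup H] [InnerProductSpace ℂ H]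
    [CompleteSpace H] {T : H →L[ℂ] H} (hT : T.IsPositive) : ∃ A, IsSelfAdjoint A ∧ A * A = T := by
  rw [← ContinuousLinearMap.nonneg_iff_isPositive] at hT
  exact ⟨CFC.sqrt T, (CFC.sqrt_nonneg T).isSelfAdjoint, CFC.sqrt_mul_sqrt_self T hT⟩

/-- With ρ = A² for a self-adjoint A, |⟨f, ρ g⟩| = |⟨A f, A g⟩| ≤ (‖A f‖² + ‖A g‖²)/2, and the trace
of ρ is the squared Hilbert–Schmidt norm of A. -/
theorem traceNorm_density_le {ρ : Op} (h : IsDensity ρ) : traceNorm ρ ≤ 1 := by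
  obtain ⟨hpos, htr⟩ := h
  obtain ⟨A, hA, hAA⟩ := exists_selfAdjoint_mul_self hpos
  have hin : ∀ x y, inner ℂ x (ρ y) = inner ℂ (A x) (A y) := by
    intro x y
    rw [← hAA, mul_apply_eq_comp, ← ContinuousLinearMap.adjoint_inner_right,
      hA.adjoint_eq]
  have hC : HasSum (fun n => ‖A (fock n)‖ ^ 2) 1 := by
    have h := htr.mapL Complex.reCLM
    convert h using 2 with n
    · rw [hin, inner_self_eq_norm_sq_to_K, Complex.reCLM_apply]
      norm_cast
    · simp
  have := traceNorm_le_ofReal (T := ρ) (C := 1) fun N f g hf hg => by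
    have h1 := sum_norm_sq_apply_le hA hC hf
    have h2 := sum_norm_sq_apply_le hA hC hg
    calc ∑ i, ‖inner ℂ (f i) (ρ (g i))‖ ≤ ∑ i, (‖A (f i)‖ ^ 2 + ‖A (g i)‖ ^ 2) / 2 := by
          refine Finset.sum_le_sum fun i _ => ?_
          rw [hin]
          refine (norm_inner_le_norm _ _).trans ?_
          nlinarith [sq_nonneg (‖A (f i)‖ - ‖A (g i)‖)]
      _ ≤ 1 := by rw [← Finset.sum_div, Finset.sum_add_distrib]; linarith
  simpa using this

/-! ### The characteristic function -/

/-- Both |n⟩ and D(α)|n⟩ are orthonormal systems, so every partial sum is among those bounded by the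
trace norm. -/
theorem summable_norm_chi {T : Op} (hT : traceNorm T ≠ ⊤) (α : ℂ) :
    Summable fun n => ‖inner ℂ (fock n) (T (displacement α (fock n)))‖ := by
  refine summable_of_sum_le (c := (traceNorm T).toReal) (fun _ => norm_nonneg _) fun s => ?_
  rw [← ENNReal.ofReal_le_iff_le_toReal hT, ENNReal.ofReal_sum_of_nonneg fun _ _ => norm_nonneg _]
  simp_rw [ofReal_norm]
  rw [← Finset.sum_coe_sort]
  exact sum_le_traceNorm T (orthonormal_fock.comp _ Subtype.val_injective)
    ((orthonormal_displacement_fock α).comp _ Subtype.val_injective)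

theorem sum_norm_chi_le (T : Op) (α : ℂ) (s : Finset ℕ) :
    ∑ n ∈ s, ‖inner ℂ (fock n) (T (displacement α (fock n)))‖ₑ ≤ traceNorm T := by
  rw [← Finset.sum_coe_sort]
  exact sum_le_traceNorm T (orthonormal_fock.comp _ Subtype.val_injective)
    ((orthonormal_displacement_fock α).comp _ Subtype.val_injective)

theorem hasSum_chi {T : Op} (hT : traceNorm T ≠ ⊤) (α : ℂ) :
    HasSum (fun n => inner ℂ (fock n) (T (displacement α (fock n)))) (chi T α) :=
  (summable_norm_chi hT α).of_norm.hasSum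

theorem enorm_chi_le {T : Op} (hT : traceNorm T ≠ ⊤) (α : ℂ) : ‖chi T α‖ₑ ≤ traceNorm T :=
  le_of_tendsto (hasSum_chi hT α).enorm <| Eventually.of_forall fun s =>
    (enorm_sum_le _ _).trans (sum_norm_chi_le T α s)

theorem chi_add {T S : Op} (hT : traceNorm T ≠ ⊤) (hS : traceNorm S ≠ ⊤) (α : ℂ) :
    chi (T + S) α = chi T α + chi S α := by
  rw [← ((hasSum_chi hT α).add (hasSum_chi hS α)).tsum_eq, chi, tr]
  simp

theorem chi_smul (c : ℝ) (T : Op) (α : ℂ) : chi (c • T) α = c * chi T α := by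
  rw [chi, chi, tr, tr, ← tsum_mul_left]
  simp [inner_smul_right_eq_smul]

theorem chi_sub {T S : Op} (hT : traceNorm T ≠ ⊤) (hS : traceNorm S ≠ ⊤) (α : ℂ) :
    chi (T - S) α = chi T α - chi S α := by
  rw [← ((hasSum_chi hT α).sub (hasSum_chi hS α)).tsum_eq, chi, tr]
  simp

theorem chi_proj (ψ : FockSpace) (α : ℂ) : chi (proj ψ) α = inner ℂ ψ (displacement α ψ) := by
  rw [← ContinuousLinearMap.adjoint_inner_left, chi, tr,
    ← (hasSum_inner_fock ((displacement α).adjoint ψ) ψ).tsum_eq]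
  refine tsum_congr fun n => ?_
  rw [ContinuousLinearMap.comp_apply, proj, InnerProductSpace.inner_right_rankOne_apply,
    ContinuousLinearMap.adjoint_inner_left, mul_comm]

theorem isDensity_proj {ψ : FockSpace} (hψ : ‖ψ‖ = 1) : IsDensity (proj ψ) := by
  refine ⟨InnerProductSpace.isPositive_rankOne_self ψ, ?_⟩
  have h := hasSum_inner_fock ψ ψ
  rw [inner_self_eq_norm_sq_to_K, hψ] at h
  have e : (fun n => inner ℂ (fock n) (proj ψ (fock n))) =
      fun n => inner ℂ ψ (fock n) * inner ℂ (fock n) ψ := by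
    funext n
    rw [proj, InnerProductSpace.inner_right_rankOne_apply, mul_comm]
  rw [e]
  simpa using h

theorem ofReal_exp_norm_sq (α : ℂ) :
    (Real.exp (‖α‖ ^ 2 / 2) : ℂ) = Complex.exp (conj α * α / 2) := by
  rw [Complex.conj_mul']; push_cast; rfl

theorem inner_expVec_displacement (α β γ : ℂ) :
    inner ℂ (expVec β) (displacement α (expVec γ)) =
      Complex.exp (-(conj α * γ) - (conj α * α) / 2 + conj β * (γ + α)) := by
  rw [displacement_expVec, inner_smul_right, inner_expVec_expVec, ← Complex.exp_add]

theorem norm_coherent (β : ℂ) : ‖coherent β‖ = 1 := by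
  have h : inner ℂ (coherent β) (coherent β) = 1 := by
    rw [coherent_eq, inner_smul_left, inner_smul_right, inner_expVec_expVec, ← Complex.exp_conj,
      ← Complex.exp_add, ← Complex.exp_add, Complex.exp_eq_one_iff]
    refine ⟨0, ?_⟩
    simp only [map_div₀, map_neg, map_mul, Complex.conj_conj, map_ofNat]
    push_cast
    ring
  have h' : ‖coherent β‖ ^ 2 = 1 := by rw [← inner_self_eq_norm_sq (𝕜 := ℂ), h]; simp
  exact (pow_eq_one_iff_of_nonneg (norm_nonneg _) two_ne_zero).1 h'

theorem chi_coherent (β α : ℂ) : chi (proj (coherent β)) α =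
    Complex.exp (-(conj α * α) / 2) * Complex.exp (α * conj β - conj α * β) := by
  rw [chi_proj, coherent_eq, map_smul, inner_smul_left, inner_smul_right,
    inner_expVec_displacement, ← Complex.exp_conj, ← Complex.exp_add, ← Complex.exp_add,
    ← Complex.exp_add]
  congr 1
  simp only [map_div₀, map_neg, map_mul, Complex.conj_conj, map_ofNat]
  ring

/-- The Gaussian factors cancel and the exponent αβ* − α*β is purely imaginary. -/
theorem norm_chiNormal_coherent (β α : ℂ) : ‖chiNormal (proj (coherent β)) α‖ = 1 := by
  rw [chiNormal, chi_coherent, ofReal_exp_norm_sq, ← Complex.exp_add, ← Complex.exp_add,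
    Complex.norm_exp, Real.exp_eq_one_iff]
  simp
  ring

/-! ### Classical states and the robustness bound -/

theorem norm_chiNormal (T : Op) (α : ℂ) :
    ‖chiNormal T α‖ = Real.exp (‖α‖ ^ 2 / 2) * ‖chi T α‖ := by
  rw [chiNormal, norm_mul, Complex.norm_real, Real.norm_of_nonneg (Real.exp_pos _).le]

/-- The trace norm bound is carried along because additivity of `chi` is available only for
operators of finite trace norm. -/
theorem convexHull_coherent_subset :
    convexHull ℝ (Set.range fun α : ℂ => proj (coherent α)) ⊆
      {T | traceNorm T ≤ 1 ∧ ∀ α, ‖chiNormal T α‖ ≤ 1} := by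
  refine convexHull_min ?_ ?_
  · rintro _ ⟨β, rfl⟩
    refine ⟨(traceNorm_rankOne_le _ _).trans (by simp [norm_coherent]), fun α =>
      (norm_chiNormal_coherent β α).le⟩
  · intro T hT S hS a b ha hb hab
    have h1 : traceNorm (a • T) ≤ ENNReal.ofReal a := (traceNorm_smul_le a T).trans (by
      rw [Real.enorm_of_nonneg ha]; exact mul_le_of_le_one_right zero_le hT.1)
    have h2 : traceNorm (b • S) ≤ ENNReal.ofReal b := (traceNorm_smul_le b S).trans (by
      rw [Real.enorm_of_nonneg hb]; exact mul_le_of_le_one_right zero_le hS.1)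
    refine ⟨(traceNorm_add_le _ _).trans ((add_le_add h1 h2).trans ?_), fun α => ?_⟩
    · rw [← ENNReal.ofReal_add ha hb, hab, ENNReal.ofReal_one]
    · rw [chiNormal, chi_add (ne_top_of_le_ne_top ENNReal.ofReal_ne_top h1)
        (ne_top_of_le_ne_top ENNReal.ofReal_ne_top h2), chi_smul, chi_smul]
      have e : (Real.exp (‖α‖ ^ 2 / 2) : ℂ) * (a * chi T α + b * chi S α) =
          a * chiNormal T α + b * chiNormal S α := by rw [chiNormal, chiNormal]; ring
      rw [e]
      refine (norm_add_le _ _).trans ?_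
      rw [norm_mul, norm_mul, Complex.norm_real, Complex.norm_real, Real.norm_of_nonneg ha,
        Real.norm_of_nonneg hb, ← hab]
      exact add_le_add (mul_le_of_le_one_right ha (hT.2 α)) (mul_le_of_le_one_right hb (hS.2 α))

theorem traceNorm_classical_ne_top {σ : Op} (h : σ ∈ classicalStates) : traceNorm σ ≠ ⊤ := by
  obtain ⟨τ, hτ, hlt⟩ := h 1 one_pos
  have h1 := (convexHull_coherent_subset hτ).1
  rw [← sub_add_cancel σ τ]
  exact ne_top_of_le_ne_top (ENNReal.add_ne_top.2 ⟨hlt.ne_top, (h1.trans_lt ENNReal.one_lt_top).ne⟩)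
    (traceNorm_add_le _ _)

theorem norm_chiNormal_classical_le {σ : Op} (h : σ ∈ classicalStates) (α : ℂ) :
    ‖chiNormal σ α‖ ≤ 1 := by
  refine le_of_forall_pos_le_add fun ε hε => ?_
  -- At fixed α the trace-norm error is amplified by e^{‖α‖²/2}, so the tolerance is divided by this
  -- factor in advance.
  obtain ⟨τ, hτ, hlt⟩ := h (ENNReal.ofReal (ε / Real.exp (‖α‖ ^ 2 / 2)))
    (ENNReal.ofReal_pos.2 (by positivity))
  obtain ⟨h1, h2⟩ := convexHull_coherent_subset hτ
  have hτt : traceNorm τ ≠ ⊤ := (h1.trans_lt ENNReal.one_lt_top).ne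
  have h3 : ‖chi (σ - τ) α‖ ≤ ε / Real.exp (‖α‖ ^ 2 / 2) := by
    have := (enorm_chi_le hlt.ne_top α).trans hlt.le
    rw [← ofReal_norm] at this
    exact (ENNReal.ofReal_le_ofReal_iff (by positivity)).1 this
  have h4 : chiNormal σ α = chiNormal τ α + chiNormal (σ - τ) α := by
    rw [chiNormal, chiNormal, chiNormal, chi_sub (traceNorm_classical_ne_top h) hτt]; ring
  rw [h4]
  refine (norm_add_le _ _).trans (add_le_add (h2 α) ?_)
  rw [norm_chiNormal]
  rwa [le_div_iff₀' (Real.exp_pos _)] at h3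

theorem norm_chiNormal_le_of_feasible {ρ σ : Op} (hρ : IsDensity ρ) {l : ℝ≥0}
    (hσ : σ ∈ classicalStates) (h : (1 + (l : ℝ))⁻¹ • (ρ + (l : ℝ) • σ) ∈ classicalStates) (α : ℂ) :
    ‖chiNormal ρ α‖ ≤ 1 + 2 * l := by
  have hl : (0 : ℝ) < 1 + l := by positivity
  have hρt : traceNorm ρ ≠ ⊤ := ((traceNorm_density_le hρ).trans_lt ENNReal.one_lt_top).ne
  have hσt : traceNorm ((l : ℝ) • σ) ≠ ⊤ := ne_top_of_le_ne_top
    (ENNReal.mul_ne_top (by simp) (traceNorm_classical_ne_top hσ)) (traceNorm_smul_le _ _)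
  have h1 := norm_chiNormal_classical_le h α
  have h2 := norm_chiNormal_classical_le hσ α
  have e : chiNormal ρ α = ((1 + l : ℝ) : ℂ) * chiNormal ((1 + (l : ℝ))⁻¹ • (ρ + (l : ℝ) • σ)) α -
      ((l : ℝ) : ℂ) * chiNormal σ α := by
    rw [chiNormal, chiNormal, chiNormal, chi_smul, chi_add hρt hσt, chi_smul]
    have : ((1 + l : ℝ) : ℂ) ≠ 0 := by exact_mod_cast hl.ne'
    rw [Complex.ofReal_inv]
    field_simp
    ring
  rw [e]
  refine (norm_sub_le _ _).trans ?_
  rw [norm_mul, norm_mul, Complex.norm_real, Complex.norm_real, Real.norm_of_nonneg hl.le,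
    Real.norm_of_nonneg l.coe_nonneg]
  nlinarith [l.coe_nonneg]

theorem robustness_lower_bound {ρ : Op} (hρ : IsDensity ρ) :
    ((⨆ α : ℂ, ‖chiNormal ρ α‖ₑ) + 1) / 2 ≤ nonclassicalityRobustness ρ := by
  refine le_iInf fun l => le_iInf fun ⟨σ, hσ, h⟩ => ?_
  rw [ENNReal.div_le_iff two_ne_zero ENNReal.ofNat_ne_top]
  have h1 : (⨆ α : ℂ, ‖chiNormal ρ α‖ₑ) ≤ 1 + 2 * (l : ℝ≥0∞) := iSup_le fun α => by
    have := norm_chiNormal_le_of_feasible hρ hσ h α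
    rw [← ofReal_norm]
    refine (ENNReal.ofReal_le_ofReal this).trans (le_of_eq ?_)
    rw [ENNReal.ofReal_add zero_le_one (by positivity), ENNReal.ofReal_mul (by norm_num)]
    simp
  calc (⨆ α : ℂ, ‖chiNormal ρ α‖ₑ) + 1 ≤ 1 + 2 * (l : ℝ≥0∞) + 1 := by gcongr
    _ = (1 + (l : ℝ≥0∞)) * 2 := by ring

theorem robustness_eq_top {ρ : Op} (hρ : IsDensity ρ) (h : UnboundedChi ρ) :
    nonclassicalityRobustness ρ = ⊤ := by
  have hs : (⨆ α : ℂ, ‖chiNormal ρ α‖ₑ) = ⊤ := by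
    by_contra hne
    refine h ⟨(⨆ α : ℂ, ‖chiNormal ρ α‖ₑ).toReal, ?_⟩
    rintro _ ⟨α, rfl⟩
    dsimp only
    rw [← ENNReal.ofReal_le_iff_le_toReal hne, ofReal_norm]
    exact le_iSup (fun α : ℂ => ‖chiNormal ρ α‖ₑ) α
  have := robustness_lower_bound hρ
  rw [hs, top_add, ENNReal.top_div_of_ne_top ENNReal.ofNat_ne_top] at this
  exact top_le_iff.1 this

/-! ### The squeezing generator -/

/-- The vector `r (a² - a†²) / 2 |n⟩`. -/
def squeezingW (r : ℝ) (n : ℕ) : FockSpace :=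
  ((r : ℂ) / 2 * ((Real.sqrt (n : ℝ) : ℂ) * (Real.sqrt ((n - 1 : ℕ) : ℝ) : ℂ))) • fock (n - 1 - 1) -
    ((r : ℂ) / 2 * ((Real.sqrt ((n : ℝ) + 1) : ℂ) * (Real.sqrt (((n + 1 : ℕ) : ℝ) + 1) : ℂ))) •
      fock (n + 1 + 1)

theorem squeezingGenerator_apply (r : ℝ) (f : ℕ → ℂ) (n : ℕ) :
    squeezingGenerator r f n = (r : ℂ) / 2 *
      ((Real.sqrt ((n : ℝ) + 1) : ℂ) * ((Real.sqrt (((n + 1 : ℕ) : ℝ) + 1) : ℂ) * f (n + 1 + 1)) -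
      (Real.sqrt (n : ℝ) : ℂ) * ((Real.sqrt ((n - 1 : ℕ) : ℝ) : ℂ) * f (n - 1 - 1))) := by
  rw [squeezingGenerator, pow_two, pow_two]
  rfl

theorem isSkewLadder_squeezing (r : ℝ) :
    IsSkewLadder (squeezingGenerator r) (squeezingW r) where
  coe_eq n := by
    ext m
    rw [squeezingGenerator_apply, squeezingW, lp.coeFn_sub, lp.coeFn_smul, lp.coeFn_smul]
    simp only [Pi.sub_apply, Pi.smul_apply, fock_apply, smul_eq_mul]
    rw [mul_sub]
    congr 1
    · rcases n with _ | _ | n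
      · simp
      · simp
      · by_cases h : m = n
        · subst h; simp; exact Or.inl (by ring)
        · simp [h]
    · rcases m with _ | _ | m
      · simp
      · simp
      · by_cases h : m = n
        · subst h; simp; exact Or.inl (by ring)
        · simp [h]
  skew y n := by
    rw [squeezingGenerator_apply, squeezingW, inner_sub_left, inner_smul_left,
      inner_smul_left, inner_fock_left, inner_fock_left]
    simp only [map_mul, map_div₀, map_ofNat, Complex.conj_ofReal]
    ring

theorem finBound_squeezingW (r : ℝ) (n : ℕ) :
    FinBound (n + 2) (|r| * (n + 2)) (squeezingW r n) := by
  have h1 := ((FinBound.fock (n - 1 - 1)).mono (by omega : n - 1 - 1 ≤ n + 2) le_rfl).smul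
    ((r : ℂ) / 2 * ((Real.sqrt (n : ℝ) : ℂ) * (Real.sqrt ((n - 1 : ℕ) : ℝ) : ℂ)))
  have h2 := (FinBound.fock (n + 1 + 1)).smul (-((r : ℂ) / 2 *
    ((Real.sqrt ((n : ℝ) + 1) : ℂ) * (Real.sqrt (((n + 1 : ℕ) : ℝ) + 1) : ℂ))))
  have := h1.add h2
  rw [neg_smul, ← sub_eq_add_neg] at this
  refine this.mono le_rfl ?_
  have hs : ∀ x : ℝ, x ≤ n + 2 → ‖(Real.sqrt x : ℂ)‖ ≤ Real.sqrt (n + 2) := fun x hx => by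
    rw [Complex.norm_real, Real.norm_of_nonneg (Real.sqrt_nonneg _)]
    exact Real.sqrt_le_sqrt hx
  have hss : Real.sqrt ((n : ℝ) + 2) * Real.sqrt (n + 2) = n + 2 :=
    Real.mul_self_sqrt (by positivity)
  have hr : ‖(r : ℂ) / 2‖ = |r| / 2 := by
    rw [norm_div, Complex.norm_real, Real.norm_eq_abs]; norm_num
  have hsub : ((n - 1 : ℕ) : ℝ) ≤ n + 2 := by
    have : ((n - 1 : ℕ) : ℝ) ≤ n := by exact_mod_cast Nat.sub_le n 1
    linarith
  rw [norm_neg, norm_mul, norm_mul, norm_mul, norm_mul, hr, mul_one, mul_one]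
  calc |r| / 2 * (‖(Real.sqrt (n : ℝ) : ℂ)‖ * ‖(Real.sqrt ((n - 1 : ℕ) : ℝ) : ℂ)‖) +
        |r| / 2 * (‖(Real.sqrt ((n : ℝ) + 1) : ℂ)‖ * ‖(Real.sqrt (((n + 1 : ℕ) : ℝ) + 1) : ℂ)‖)
      ≤ |r| / 2 * (Real.sqrt (n + 2) * Real.sqrt (n + 2)) +
        |r| / 2 * (Real.sqrt (n + 2) * Real.sqrt (n + 2)) := by
        gcongr
        · exact hs _ (by linarith)
        · exact hs _ hsub
        · exact hs _ (by linarith)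
        · exact hs _ (by push_cast; linarith)
    _ = |r| * (n + 2) := by rw [hss]; ring

/-- The weights |r|(n + 2j + 2) grow linearly with slope 2|r|, so this bound gives only a finite
interval of convergence. The extra 1 in the rate absorbs |r| n for large j, making the interval
independent of n. -/
theorem coreDeriv_squeezing (r : ℝ) (n : ℕ) {t : ℝ} (ht : |t| < 1 / (2 * |r| + 1)) :
    CoreDeriv (squeezingGenerator r) (expOrbit (squeezingW r) 2 n) t := by
  have hK : 0 < 2 * |r| + 1 := by positivity
  obtain ⟨C, hC⟩ := exists_prod_le_factorial
    (w := fun j => |r| * (((n + 2 * j : ℕ) : ℝ) + 2)) hK (fun j => by positivity) (by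
      filter_upwards [tendsto_natCast_atTop_atTop.eventually_ge_atTop (|r| * n)] with j hj
      push_cast
      linarith)
  exact coreDeriv_expOrbit (isSkewLadder_squeezing r)
    (w := fun n => |r| * ((n : ℝ) + 2)) (fun a b hab => by
      have : (a : ℝ) ≤ b := by exact_mod_cast hab
      dsimp only; gcongr) (fun n => by positivity) (finBound_squeezingW r) hK hC
    ((lt_div_iff₀' hK).1 ht)

/-! ### The squeezed vacuum -/

/-- The coefficients `√(2k)! / (2ᵏ k!)`. -/
def sqCoeff (k : ℕ) : ℝ := Real.sqrt ((2 * k).factorial : ℝ) / (2 ^ k * k.factorial)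

theorem sqrt_two_mul_factorial (k : ℕ) : Real.sqrt ((2 * (k + 1)).factorial : ℝ) =
    Real.sqrt (2 * k + 1) * Real.sqrt (2 * k + 2) * Real.sqrt ((2 * k).factorial : ℝ) := by
  rw [← Real.sqrt_mul (by positivity), ← Real.sqrt_mul (by positivity)]
  congr 1
  rw [mul_add, mul_one, Nat.factorial_succ, Nat.factorial_succ]
  push_cast
  ring

theorem sqCoeff_succ (k : ℕ) :
    2 * (k + 1) * sqCoeff (k + 1) = Real.sqrt (2 * k + 1) * Real.sqrt (2 * k + 2) * sqCoeff k := by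
  rw [sqCoeff, sqCoeff, sqrt_two_mul_factorial, Nat.factorial_succ, pow_succ]
  push_cast
  have : (k : ℝ) + 1 ≠ 0 := by positivity
  field_simp

theorem sqCoeff_succ' (k : ℕ) :
    Real.sqrt (2 * k + 1) * Real.sqrt (2 * k + 2) * sqCoeff (k + 1) = (2 * k + 1) * sqCoeff k := by
  have h := sqCoeff_succ k
  have h1 : Real.sqrt (2 * k + 1) * Real.sqrt (2 * k + 1) = 2 * k + 1 :=
    Real.mul_self_sqrt (by positivity)
  have h2 : Real.sqrt (2 * k + 2) * Real.sqrt (2 * k + 2) = 2 * k + 2 :=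
    Real.mul_self_sqrt (by positivity)
  have h3 : (2 * (k : ℝ) + 2) ≠ 0 := by positivity
  apply mul_left_cancel₀ h3
  calc (2 * (k : ℝ) + 2) * (Real.sqrt (2 * k + 1) * Real.sqrt (2 * k + 2) * sqCoeff (k + 1))
      = Real.sqrt (2 * k + 1) * Real.sqrt (2 * k + 2) * (2 * (k + 1) * sqCoeff (k + 1)) := by ring
    _ = (Real.sqrt (2 * k + 1) * Real.sqrt (2 * k + 1)) *
        (Real.sqrt (2 * k + 2) * Real.sqrt (2 * k + 2)) * sqCoeff k := by rw [h]; ring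
    _ = _ := by rw [h1, h2]; ring

theorem sqCoeff_pos (k : ℕ) : 0 < sqCoeff k := by unfold sqCoeff; positivity

theorem sqCoeff_le_one (k : ℕ) : sqCoeff k ≤ 1 := by
  induction k with
  | zero => simp [sqCoeff]
  | succ k ih =>
    refine le_trans ?_ ih
    have h := sqCoeff_succ k
    have h1 : Real.sqrt (2 * k + 1) * Real.sqrt (2 * k + 2) ≤ 2 * (k + 1) := by
      calc Real.sqrt (2 * k + 1) * Real.sqrt (2 * k + 2)
          ≤ Real.sqrt (2 * k + 2) * Real.sqrt (2 * k + 2) := by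
            gcongr; linarith
        _ = 2 * (k + 1) := by rw [Real.mul_self_sqrt (by positivity)]; ring
    have h2 := mul_le_mul_of_nonneg_right h1 (sqCoeff_pos k).le
    rw [← h] at h2
    exact le_of_mul_le_mul_left h2 (by positivity)

/-- The unnormalised squeezed vector `∑ₖ zᵏ √(2k)! / (2ᵏ k!) |2k⟩`. -/
def sqVec (z : ℂ) : FockSpace := powerVec (fun k => (sqCoeff k : ℂ) • fock (2 * k)) z

theorem norm_sqVec_coeff_le (k : ℕ) : ‖(sqCoeff k : ℂ) • fock (2 * k)‖ ≤ 1 * 1 ^ k := by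
  rw [norm_smul, norm_fock, Complex.norm_real, Real.norm_of_nonneg (sqCoeff_pos k).le]
  simpa using sqCoeff_le_one k

theorem hasSum_sqVec {z : ℂ} (hz : ‖z‖ < 1) :
    HasSum (fun k => z ^ k • (sqCoeff k : ℂ) • fock (2 * k)) (sqVec z) :=
  hasSum_powerVec zero_le_one norm_sqVec_coeff_le (by simpa using hz)

theorem hasSum_coord {f : ℕ → FockSpace} {x : FockSpace} (h : HasSum f x) (n : ℕ) :
    HasSum (fun k => f k n) (x n) := by
  simpa only [innerSL_apply_apply, inner_fock_left] using h.mapL (innerSL ℂ (fock n))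

theorem sqVec_even {z : ℂ} (hz : ‖z‖ < 1) (k : ℕ) : sqVec z (2 * k) = z ^ k * sqCoeff k := by
  refine (hasSum_coord (hasSum_sqVec hz) (2 * k)).unique ?_
  simp only [lp.coeFn_smul, Pi.smul_apply, smul_eq_mul, fock_apply]
  convert hasSum_single k fun j hj => ?_ using 1
  · simp
  · simp [hj.symm]

theorem sqVec_odd {z : ℂ} (hz : ‖z‖ < 1) (k : ℕ) : sqVec z (2 * k + 1) = 0 := by
  refine (hasSum_coord (hasSum_sqVec hz) (2 * k + 1)).unique ?_
  simp only [lp.coeFn_smul, Pi.smul_apply, smul_eq_mul, fock_apply]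
  convert hasSum_zero with j
  have : ¬ (2 * k + 1 = 2 * j) := by omega
  simp [this]

theorem exists_hasDerivAt_sqVec {z : ℂ} (hz : ‖z‖ < 1) : ∃ v : FockSpace, HasDerivAt sqVec v z ∧
    (∀ k : ℕ, v (2 * k) = k * z ^ (k - 1) * sqCoeff k) ∧ ∀ k, v (2 * k + 1) = 0 := by
  obtain ⟨v, hv, hd⟩ := hasDerivAt_powerVec one_pos norm_sqVec_coeff_le
    (by simpa using hz : 1 * ‖z‖ < 1)
  refine ⟨v, hd, fun k => ?_, fun k => ?_⟩
  · refine (hasSum_coord hv (2 * k)).unique ?_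
    simp only [lp.coeFn_smul, Pi.smul_apply, smul_eq_mul, fock_apply]
    rcases k with _ | k
    · convert hasSum_zero with j
      · simp
      · simp
    · convert hasSum_single k fun j hj => ?_ using 1
      · simp; ring
      · simp [hj.symm]
  · refine (hasSum_coord hv (2 * k + 1)).unique ?_
    simp only [lp.coeFn_smul, Pi.smul_apply, smul_eq_mul, fock_apply]
    convert hasSum_zero with j
    have : ¬ (2 * k + 1 = 2 * (j + 1)) := by omega
    simp [this]

/-- The vectors A|2k⟩ grow linearly in k against the geometric factor ‖z‖ᵏ, so A can be applied
termwise. The value q need not be identified, since it is forced to be the maximal action. -/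
theorem exists_coreAct_sqVec (r : ℝ) {z : ℂ} (hz : ‖z‖ < 1) :
    ∃ q, CoreAct (squeezingGenerator r) (sqVec z) q := by
  have hs : Summable fun k : ℕ => z ^ k • (sqCoeff k : ℂ) • squeezingW r (2 * k) := by
    have h1 := summable_pow_mul_geometric_of_norm_lt_one 1 (r := ‖z‖) (by simpa using hz)
    have h0 := summable_geometric_of_lt_one (norm_nonneg z) hz
    refine Summable.of_norm_bounded ((h1.add h0).mul_left (2 * |r|)) fun k => ?_
    rw [norm_smul, norm_smul, norm_pow, Complex.norm_real, Real.norm_of_nonneg (sqCoeff_pos k).le]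
    calc ‖z‖ ^ k * (sqCoeff k * ‖squeezingW r (2 * k)‖)
        ≤ ‖z‖ ^ k * (1 * (|r| * (((2 * k : ℕ) : ℝ) + 2))) := by
          gcongr
          · exact sqCoeff_le_one k
          · exact (finBound_squeezingW r (2 * k)).norm_le
      _ = _ := by push_cast; ring
  exact ⟨_, CoreAct.hasSum (hasSum_sqVec hz) hs.hasSum fun k =>
    (((isSkewLadder_squeezing r).coreAct_fock (2 * k)).smul _).smul _⟩

/-- The orbit of the vacuum under squeezing. -/
def squeezedOrbit (r t : ℝ) : FockSpace :=
  (((Real.sqrt (Real.cosh (r * t)))⁻¹ : ℝ) : ℂ) • sqVec ((-Real.tanh (r * t) : ℝ) : ℂ)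

theorem norm_neg_tanh_lt_one (x : ℝ) : ‖((-Real.tanh x : ℝ) : ℂ)‖ < 1 := by
  rw [Complex.norm_real, norm_neg, Real.norm_eq_abs]
  exact Real.abs_tanh_lt_one x

theorem hasDerivAt_neg_tanh (r t : ℝ) : HasDerivAt (fun t => -Real.tanh (r * t))
    (-r * (1 - (-Real.tanh (r * t)) ^ 2)) t := by
  have hc := (Real.cosh_pos (r * t)).ne'
  have h0 : HasDerivAt (fun t => r * t) r t := by simpa using (hasDerivAt_id t).const_mul r
  have h1 : HasDerivAt Real.tanh (1 - Real.tanh (r * t) ^ 2) (r * t) := by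
    have h := (Real.hasDerivAt_sinh (r * t)).div (Real.hasDerivAt_cosh (r * t)) hc
    have e : Real.tanh = Real.sinh / Real.cosh := funext fun x => Real.tanh_eq_sinh_div_cosh x
    rw [e]
    refine h.congr_deriv ?_
    rw [Pi.div_apply]
    field_simp
  exact (h1.comp t h0).neg.congr_deriv (by ring)

theorem hasDerivAt_inv_sqrt_cosh (r t : ℝ) :
    HasDerivAt (fun t => (Real.sqrt (Real.cosh (r * t)))⁻¹)
      (r / 2 * (-Real.tanh (r * t)) * (Real.sqrt (Real.cosh (r * t)))⁻¹) t := by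
  have hc := Real.cosh_pos (r * t)
  have h0 : HasDerivAt (fun t => r * t) r t := by simpa using (hasDerivAt_id t).const_mul r
  have h1 := ((Real.hasDerivAt_cosh (r * t)).comp t h0).sqrt hc.ne'
  have h2 := h1.inv (by simpa using (Real.sqrt_pos.2 hc).ne')
  refine h2.congr_deriv ?_
  have hs := Real.sq_sqrt hc.le
  have hs0 := (Real.sqrt_pos.2 hc).ne'
  rw [Real.tanh_eq_sinh_div_cosh]
  dsimp only [Function.comp]
  rw [hs]
  field_simp

/-- With z = −tanh(rt) and c = cosh(rt)^{-1/2} one has z′ = −r(1 − z²) and c′ = (r/2) z c. Comparing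
coefficients of |2k⟩, `sqCoeff_succ'` handles the a² term and `sqCoeff_succ` the a†² term. -/
theorem maxDeriv_squeezedOrbit (r t : ℝ) :
    MaxDeriv (squeezingGenerator r) (squeezedOrbit r) t := by
  have hz := norm_neg_tanh_lt_one (r * t)
  obtain ⟨v, hv, hv0, hv1⟩ := exists_hasDerivAt_sqVec hz
  have hS : HasDerivAt (fun t => sqVec ((-Real.tanh (r * t) : ℝ) : ℂ)) _ t :=
    hv.scomp t (hasDerivAt_neg_tanh r t).ofReal_comp
  refine ⟨_, ?_, (hasDerivAt_inv_sqrt_cosh r t).ofReal_comp.smul hS⟩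
  ext m
  rw [squeezingGenerator_apply, squeezedOrbit]
  simp only [lp.coeFn_add, lp.coeFn_smul, Pi.add_apply, Pi.smul_apply, smul_eq_mul]
  have hz' : ((-r * (1 - (-Real.tanh (r * t)) ^ 2) : ℝ) : ℂ) =
      -r * (1 - ((-Real.tanh (r * t) : ℝ) : ℂ) ^ 2) := by push_cast; ring
  have hc' : ((r / 2 * (-Real.tanh (r * t)) * (Real.sqrt (Real.cosh (r * t)))⁻¹ : ℝ) : ℂ) =
      r / 2 * ((-Real.tanh (r * t) : ℝ) : ℂ) * (((Real.sqrt (Real.cosh (r * t)))⁻¹ : ℝ) : ℂ) := by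
    push_cast; ring
  rw [hz', hc']
  generalize ((-Real.tanh (r * t) : ℝ) : ℂ) = z at hz hv hv0 hv1 ⊢
  generalize (((Real.sqrt (Real.cosh (r * t)))⁻¹ : ℝ) : ℂ) = c
  obtain ⟨k, rfl | rfl⟩ := Nat.even_or_odd' m
  · have e1 : 2 * k + 1 + 1 = 2 * (k + 1) := by ring
    rw [e1, sqVec_even hz, sqVec_even hz, hv0]
    have h1 : (Real.sqrt (((2 * k : ℕ) : ℝ) + 1) : ℂ) *
        (Real.sqrt (((2 * k + 1 : ℕ) : ℝ) + 1) : ℂ) * (sqCoeff (k + 1) : ℂ) =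
        (2 * k + 1) * sqCoeff k := by
      have e : ((2 * k + 1 : ℕ) : ℝ) + 1 = 2 * k + 2 := by push_cast; ring
      have e' : ((2 * k : ℕ) : ℝ) + 1 = 2 * k + 1 := by push_cast; ring
      rw [e, e']
      exact_mod_cast congrArg (fun x : ℝ => (x : ℂ)) (sqCoeff_succ' k)
    -- At level 0 the truncated index n − 1 − 1 is again 0, and the a†² term vanishes only through
    -- its factor √0.
    rcases k with _ | k
    · simp only [mul_zero, Nat.cast_zero, Real.sqrt_zero, Complex.ofReal_zero, zero_mul] at h1 ⊢
      linear_combination (-r / 2 * c * z) * h1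
    · have e2 : 2 * (k + 1) - 1 - 1 = 2 * k := by omega
      rw [e2, sqVec_even hz, Nat.add_sub_cancel]
      have h2 : (Real.sqrt ((2 * (k + 1) : ℕ) : ℝ) : ℂ) *
          (Real.sqrt ((2 * (k + 1) - 1 : ℕ) : ℝ) : ℂ) * (sqCoeff k : ℂ) =
          2 * (k + 1) * sqCoeff (k + 1) := by
        have e : ((2 * (k + 1) : ℕ) : ℝ) = 2 * k + 2 := by push_cast; ring
        have e' : ((2 * (k + 1) - 1 : ℕ) : ℝ) = 2 * k + 1 := by
          rw [show 2 * (k + 1) - 1 = 2 * k + 1 by omega]; push_cast; ring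
        rw [e, e', mul_comm (Real.sqrt (2 * (k : ℝ) + 2) : ℂ)]
        exact_mod_cast congrArg (fun x : ℝ => (x : ℂ)) (sqCoeff_succ k).symm
      push_cast at h1 h2 ⊢
      linear_combination (-r / 2 * c * z ^ (k + 2)) * h1 + (r / 2 * c * z ^ k) * h2
  · have e1 : 2 * k + 1 + 1 + 1 = 2 * (k + 1) + 1 := by ring
    rw [e1, sqVec_odd hz, sqVec_odd hz, hv1]
    rcases k with _ | k
    · simp
    · have e2 : 2 * (k + 1) + 1 - 1 - 1 = 2 * k + 1 := by omega
      rw [e2, sqVec_odd hz]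
      ring

theorem squeezedOrbit_zero (r : ℝ) : squeezedOrbit r 0 = fock 0 := by
  have : sqVec 0 = fock 0 := by
    refine (hasSum_sqVec (by simp)).unique ?_
    convert hasSum_single 0 fun j hj => ?_ using 1
    · simp [sqCoeff]
    · simp [hj]
  simp [squeezedOrbit, this]

theorem norm_squeezedOrbit (r t : ℝ) : ‖squeezedOrbit r t‖ = 1 := by
  have hm := maxDeriv_squeezedOrbit r
  -- Conservation of the norm needs the orbit in the smaller domain too; the core action and the
  -- derivative have the same coefficients, hence coincide.
  have hcore : ∀ t, CoreDeriv (squeezingGenerator r) (squeezedOrbit r) t := by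
    intro t
    obtain ⟨v, hv, hd⟩ := hm t
    obtain ⟨q, hq⟩ := exists_coreAct_sqVec r (norm_neg_tanh_lt_one (r * t))
    have hq' : CoreAct (squeezingGenerator r) (squeezedOrbit r t) _ := hq.smul _
    have : v = _ := lp.ext (hv.trans ((isSkewLadder_squeezing r).coe_of_coreAct hq').symm)
    exact ⟨v, hd, this ▸ hq'⟩
  have h := inner_const isOpen_univ isPreconnected_univ (fun s _ => hm s) (fun s _ => hcore s)
    (Set.mem_univ t) (Set.mem_univ 0)
  have h' : ‖squeezedOrbit r t‖ ^ 2 = 1 := by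
    rw [← inner_self_eq_norm_sq (𝕜 := ℂ), h, squeezedOrbit_zero, inner_self_eq_norm_sq, norm_fock,
      one_pow]
  exact (pow_eq_one_iff_of_nonneg (norm_nonneg _) two_ne_zero).1 h'

theorem isExpVec_squeezed_iff (r : ℝ) (ζ : FockSpace) :
    IsExpVec (squeezingGenerator r) (fock 0) ζ ↔ ζ = squeezedOrbit r 1 := by
  constructor
  · rintro ⟨u, hu, hu0, rfl⟩
    exact orbit_unique (δ := 1 / (2 * |r| + 1)) (by positivity)
      (fun n => ⟨_, expOrbit_zero _ _ n, fun t ht => coreDeriv_squeezing r n ht⟩) hu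
      (maxDeriv_squeezedOrbit r) (hu0.trans (squeezedOrbit_zero r).symm) 1
  · rintro rfl
    exact ⟨_, maxDeriv_squeezedOrbit r, squeezedOrbit_zero r, rfl⟩

theorem squeezed_eq (r : ℝ) : squeezed r = squeezedOrbit r 1 :=
  (isExpVec_squeezed_iff r _).1 (Classical.epsilon_spec
    (p := IsExpVec (squeezingGenerator r) (fock 0)) ⟨_, (isExpVec_squeezed_iff r _).2 rfl⟩)

theorem hasSum_of_eq {f g : ℕ → ℂ} {a b : ℂ} (h : HasSum f a) (hfg : ∀ n, g n = f n)
    (hab : b = a) : HasSum g b := by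
  rwa [funext hfg, hab]

/-! ### Characteristic functions of pure states in the Bargmann representation -/

theorem unboundedChi_of_tendsto {ρ : Op} {f : ℝ → ℂ} {g : ℝ → ℝ} (hg : Tendsto g atTop atTop)
    (h : ∀ x, g x ≤ ‖chiNormal ρ (f x)‖) : UnboundedChi ρ := by
  rintro ⟨C, hC⟩
  obtain ⟨x, hx⟩ := (hg.eventually_gt_atTop C).exists
  exact absurd ((h x).trans (hC ⟨f x, rfl⟩)) (not_le.2 hx)

theorem isDensity_and_robustness {ψ : FockSpace} (hψ : ‖ψ‖ = 1) (h : UnboundedChi (proj ψ)) :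
    IsDensity (proj ψ) ∧ UnboundedChi (proj ψ) ∧ nonclassicalityRobustness (proj ψ) = ⊤ :=
  ⟨isDensity_proj hψ, h, robustness_eq_top (isDensity_proj hψ) h⟩

/-- The normally ordered displacement operator applied to `ψ`. -/
def normalDisp (α : ℂ) (ψ : FockSpace) : FockSpace :=
  Complex.exp (conj α * α / 2) • displacement α ψ

theorem chiNormal_proj (ψ : FockSpace) (α : ℂ) :
    chiNormal (proj ψ) α = inner ℂ ψ (normalDisp α ψ) := by
  rw [chiNormal, chi_proj, ofReal_exp_norm_sq, normalDisp, inner_smul_right]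

theorem inner_expVec_normalDisp (α β : ℂ) (ψ : FockSpace) :
    inner ℂ (expVec β) (normalDisp α ψ) =
      Complex.exp (α * conj β) * inner ℂ (expVec (β - α)) ψ := by
  rw [← adjoint_displacement_expVec α (β - α), ContinuousLinearMap.adjoint_inner_left,
    inner_smul_left, normalDisp, inner_smul_right, sub_add_cancel, ← mul_assoc,
    ← Complex.exp_conj, ← Complex.exp_add]
  congr 2
  simp only [map_div₀, map_neg, map_mul, map_sub, Complex.conj_conj, map_ofNat]
  ring

/-- The Bargmann function `∑ₙ ψₙ wⁿ / √(n!)` of a vector. -/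
def bargmann (ψ : FockSpace) (w : ℂ) : ℂ := inner ℂ (expVec (conj w)) ψ

theorem hasSum_bargmann (ψ : FockSpace) (w : ℂ) :
    HasSum (fun n => w ^ n * (ψ n / (Real.sqrt (n.factorial : ℝ) : ℂ))) (bargmann ψ w) := by
  simpa [bargmann] using inner_expVec_left (conj w) ψ

/-- The Bargmann form of the normal ordering e^{αa†} e^{−α*a}: a† acts by multiplication by w, a by
differentiation. -/
theorem bargmann_normalDisp (α w : ℂ) (ψ : FockSpace) :
    bargmann (normalDisp α ψ) w = Complex.exp (α * w) * bargmann ψ (w - conj α) := by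
  rw [bargmann, inner_expVec_normalDisp, bargmann, Complex.conj_conj, map_sub, Complex.conj_conj]

theorem hasSum_exp_mul (b w : ℂ) :
    HasSum (fun n : ℕ => w ^ n * (b ^ n / (n.factorial : ℂ))) (Complex.exp (b * w)) := by
  have h := NormedSpace.expSeries_div_hasSum_exp (b * w)
  rw [← Complex.exp_eq_exp_ℂ] at h
  have e : (fun n : ℕ => w ^ n * (b ^ n / (n.factorial : ℂ))) =
      fun n : ℕ => (b * w) ^ n / (n.factorial : ℂ) := by
    funext n
    rw [mul_pow]; ring
  rwa [e]

theorem hasSum_cauchy_mul {a b : ℕ → ℂ} {w A B : ℂ} (ha : HasSum (fun n => w ^ n * a n) A)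
    (hb : HasSum (fun n => w ^ n * b n) B) :
    HasSum (fun n => w ^ n * ∑ p ∈ Finset.HasAntidiagonal.antidiagonal n, a p.1 * b p.2) (A * B) := by
  have h1 := ha.summable.norm
  have h2 := hb.summable.norm
  have e : (fun n => w ^ n * ∑ p ∈ Finset.HasAntidiagonal.antidiagonal n, a p.1 * b p.2) =
      fun n => ∑ p ∈ Finset.HasAntidiagonal.antidiagonal n, w ^ p.1 * a p.1 * (w ^ p.2 * b p.2) := by
    funext n
    rw [Finset.mul_sum]
    refine Finset.sum_congr rfl fun p hp => ?_
    rw [← Finset.HasAntidiagonal.mem_antidiagonal.1 hp, pow_add]; ring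
  rw [e, ← ha.tsum_eq, ← hb.tsum_eq,
    tsum_mul_tsum_eq_tsum_sum_antidiagonal_of_summable_norm h1 h2]
  exact (summable_norm_sum_mul_antidiagonal_of_summable_norm h1 h2).of_norm.hasSum

theorem apply_eq_of_bargmann {ψ : FockSpace} {a : ℕ → ℂ}
    (h : ∀ w, HasSum (fun n => w ^ n * a n) (bargmann ψ w)) (n : ℕ) :
    ψ n = (Real.sqrt (n.factorial : ℝ) : ℂ) * a n := by
  rw [← coeff_unique (hasSum_bargmann ψ) h n, mul_div_cancel₀ _ (sqrt_factorial_ne_zero n)]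

/-! ### Finite superpositions of Fock states -/

theorem exists_support_bound {ψ : FockSpace} (h : ψ ∈ Submodule.span ℂ (Set.range fock)) :
    ∃ M, ∀ n, M < n → ψ n = 0 := by
  induction h using Submodule.span_induction with
  | mem x hx =>
    obtain ⟨m, rfl⟩ := hx
    exact ⟨m, fun n hn => by simp [fock_apply, hn.ne']⟩
  | zero => exact ⟨0, fun n _ => rfl⟩
  | add x y _ _ hx hy =>
    obtain ⟨M, hM⟩ := hx
    obtain ⟨M', hM'⟩ := hy
    refine ⟨max M M', fun n hn => ?_⟩
    rw [lp.coeFn_add, Pi.add_apply, hM n (by omega), hM' n (by omega), add_zero]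
  | smul c x _ hx =>
    obtain ⟨M, hM⟩ := hx
    exact ⟨M, fun n hn => by rw [lp.coeFn_smul, Pi.smul_apply, hM n hn, smul_zero]⟩

theorem exists_top_coeff {ψ : FockSpace} (h : ψ ∈ Submodule.span ℂ (Set.range fock))
    (h1 : ∃ n : ℕ, 1 ≤ n ∧ ψ n ≠ 0) : ∃ N, 1 ≤ N ∧ ψ N ≠ 0 ∧ ∀ n, N < n → ψ n = 0 := by
  obtain ⟨M, hM⟩ := exists_support_bound h
  obtain ⟨n, hn, hn0⟩ := h1
  classical
  have hnM : n ≤ M := not_lt.1 fun hlt => hn0 (hM n hlt)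
  refine ⟨Nat.findGreatest (fun k => ψ k ≠ 0) M, hn.trans (Nat.le_findGreatest hnM hn0),
    Nat.findGreatest_spec (P := fun k => ψ k ≠ 0) hnM hn0, fun k hk => ?_⟩
  by_cases hkM : k ≤ M
  · exact not_not.1 (Nat.findGreatest_is_greatest hk hkM)
  · exact hM k (not_le.1 hkM)

open Polynomial in
theorem hasSum_polynomial (P : ℂ[X]) (w : ℂ) : HasSum (fun n => w ^ n * P.coeff n) (P.eval w) := by
  rw [eval_eq_sum_range]
  simp_rw [mul_comm (P.coeff _)]
  refine hasSum_sum_of_ne_finset_zero fun n hn => ?_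
  rw [coeff_eq_zero_of_natDegree_lt (by simpa [Nat.lt_succ_iff] using hn), mul_zero]

open Polynomial in
-- At α = −y with y real the Bargmann function P is shifted to P(w + y), whose Taylor coefficients
-- are Hasse derivatives at y. So χ₁ is a polynomial in y, with y^{2N} coefficient (−1)ᴺ|ψ_N|²/N!.
theorem unboundedChi_finite {ψ : FockSpace} {N : ℕ} (hN : 1 ≤ N) (hψN : ψ N ≠ 0)
    (hψ : ∀ n, N < n → ψ n = 0) : UnboundedChi (proj ψ) := by
  set c : ℕ → ℂ := fun n => ψ n / (Real.sqrt (n.factorial : ℝ) : ℂ) with hc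
  have hc0 : ∀ n, N < n → c n = 0 := fun n hn => by rw [hc]; simp [hψ n hn]
  set P : ℂ[X] := ∑ n ∈ Finset.range (N + 1), monomial n (c n) with hP
  have hPc : ∀ n, P.coeff n = c n := by
    intro n
    rw [hP, finsetSum_coeff]
    simp only [coeff_monomial]
    rw [Finset.sum_ite_eq']
    split_ifs with h
    · rfl
    · rw [hc0 n (by simpa [Nat.lt_succ_iff] using h)]
  have hF : ∀ w, bargmann ψ w = P.eval w := fun w => by
    refine (hasSum_bargmann ψ w).unique ?_
    have := hasSum_polynomial P w
    simp_rw [hPc] at this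
    exact this
  have hcoef : ∀ (y : ℝ) (n : ℕ), normalDisp (-y : ℂ) ψ n = (Real.sqrt (n.factorial : ℝ) : ℂ) *
      ∑ p ∈ Finset.HasAntidiagonal.antidiagonal n, (-y : ℂ) ^ p.1 / (p.1.factorial : ℂ) *
        (hasseDeriv p.2 P).eval (y : ℂ) := by
    intro y
    refine apply_eq_of_bargmann fun w => ?_
    rw [bargmann_normalDisp, hF]
    refine hasSum_cauchy_mul (a := fun n => (-y : ℂ) ^ n / (n.factorial : ℂ))
      (b := fun n => (hasseDeriv n P).eval (y : ℂ)) (hasSum_exp_mul _ _) ?_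
    have h := hasSum_polynomial (taylor (y : ℂ) P) w
    simp_rw [taylor_coeff] at h
    rw [taylor_eval] at h
    exact hasSum_of_eq h (fun n => rfl) (by rw [map_neg, Complex.conj_ofReal, sub_neg_eq_add])
  set G : ℂ[X] := ∑ m ∈ Finset.range (N + 1), C (conj (ψ m) * (Real.sqrt (m.factorial : ℝ) : ℂ)) *
    ∑ p ∈ Finset.HasAntidiagonal.antidiagonal m, C ((-1 : ℂ) ^ p.1 / (p.1.factorial : ℂ)) *
      (X ^ p.1 * hasseDeriv p.2 P) with hG
  have hGe : ∀ y : ℝ, chiNormal (proj ψ) (-y : ℂ) = G.eval (y : ℂ) := by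
    intro y
    rw [chiNormal_proj]
    have h := hasSum_inner_fock ψ (normalDisp (-y : ℂ) ψ)
    refine h.unique ?_
    rw [hG, eval_finsetSum]
    refine hasSum_of_eq (hasSum_sum_of_ne_finset_zero (s := Finset.range (N + 1))
      (f := fun n => inner ℂ ψ (fock n) * inner ℂ (fock n) (normalDisp (-y : ℂ) ψ)) ?_)
      (fun _ => rfl) (Finset.sum_congr rfl fun m _ => ?_)
    rotate_left
    · rw [inner_fock_right, inner_fock_left, hcoef, eval_mul, eval_C, eval_finsetSum, mul_assoc]
      congr 2
      refine Finset.sum_congr rfl fun p _ => ?_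
      rw [eval_mul, eval_mul, eval_C, eval_pow, eval_X, neg_pow (y : ℂ)]
      ring
    · intro m hm
      rw [inner_fock_right, hψ m (by simpa [Nat.lt_succ_iff] using hm), map_zero, zero_mul]
  have hGc : G.coeff (2 * N) ≠ 0 := by
    -- The term of index p has degree at most p.1 + N − p.2. With p.1 + p.2 ≤ N this reaches 2N only
    -- at p = (N, 0).
    have h0 : ∀ m ≤ N, ∀ p ∈ Finset.HasAntidiagonal.antidiagonal m, p ≠ (N, 0) →
        (X ^ p.1 * hasseDeriv p.2 P).coeff (2 * N) = 0 := by
      intro m hm p hp hne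
      have hpm := Finset.HasAntidiagonal.mem_antidiagonal.1 hp
      rw [coeff_X_pow_mul', if_pos (by omega), hasseDeriv_coeff, hPc, hc0, mul_zero]
      have : ¬ (p.1 = N ∧ p.2 = 0) := fun h => hne (Prod.ext h.1 h.2)
      omega
    rw [hG, finsetSum_coeff, Finset.sum_eq_single N]
    · rw [coeff_C_mul, finsetSum_coeff, Finset.sum_eq_single (N, 0)]
      · rw [coeff_C_mul, coeff_X_pow_mul', if_pos (by dsimp only; omega), hasseDeriv_coeff, hPc]
        have e : 2 * N - N + 0 = N := by omega
        dsimp only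
        rw [e, Nat.choose_zero_right, Nat.cast_one, one_mul, hc]
        have h1 := sqrt_factorial_ne_zero N
        have h2 : conj (ψ N) ≠ 0 := by simpa using hψN
        have h3 : (N.factorial : ℂ) ≠ 0 := by exact_mod_cast N.factorial_ne_zero
        have h4 : ((-1 : ℂ)) ^ N ≠ 0 := by simp
        exact mul_ne_zero (mul_ne_zero h2 h1) (mul_ne_zero (div_ne_zero h4 h3)
          (div_ne_zero hψN h1))
      · intro p hp hne
        rw [coeff_C_mul, h0 N le_rfl p hp hne, mul_zero]
      · intro h
        simp at h
    · intro m hm hne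
      have hmN : m ≤ N := by simpa [Nat.lt_succ_iff] using hm
      rw [coeff_C_mul, finsetSum_coeff, Finset.sum_eq_zero, mul_zero]
      intro p hp
      rw [coeff_C_mul, h0 m hmN p hp, mul_zero]
      rintro rfl
      have := Finset.HasAntidiagonal.mem_antidiagonal.1 hp
      dsimp only at this
      omega
    · intro h
      simp at h
  have hdeg : 0 < G.degree :=
    lt_of_lt_of_le (by exact_mod_cast (by omega : 0 < 2 * N)) (le_degree_of_ne_zero hGc)
  refine unboundedChi_of_tendsto (f := fun y : ℝ => (-y : ℂ)) (g := fun y => ‖G.eval (y : ℂ)‖)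
    (G.tendsto_norm_atTop hdeg ?_) fun y => by rw [hGe]
  simpa [Complex.norm_real] using tendsto_abs_atTop_atTop

/-! ### Cat states -/

/-- The even cat has a nonzero vacuum coefficient and the odd cat a nonzero one-photon coefficient.
-/
theorem catAux_ne_zero (s : ℤˣ) {α : ℂ} (hα : α ≠ 0) : catAux s α ≠ 0 := by
  intro h
  have h' : ∀ n, expVec α n + ((s : ℤ) : ℂ) * expVec (-α) n = 0 := by
    intro n
    have := congrArg (fun v : FockSpace => v n) h
    dsimp only at this
    rw [catAux, coherent_eq, coherent_eq] at this
    simp only [lp.coeFn_add, lp.coeFn_smul, Pi.add_apply, Pi.smul_apply, smul_eq_mul,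
      lp.coeFn_zero, Pi.zero_apply, map_neg, neg_mul_neg] at this
    have h0 := Complex.exp_ne_zero (-(conj α * α) / 2)
    apply mul_left_cancel₀ h0
    linear_combination this
  rcases Int.units_eq_one_or s with rfl | rfl
  · have := h' 0
    simp [expVec_apply] at this
  · have := h' 1
    simp [expVec_apply] at this
    exact hα this

theorem norm_cat (s : ℤˣ) {α : ℂ} (hα : α ≠ 0) : ‖cat s α‖ = 1 := by
  have := norm_ne_zero_iff.2 (catAux_ne_zero s hα)
  rw [cat, norm_smul, norm_inv, Complex.norm_real, norm_norm, inv_mul_cancel₀ this]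

theorem normalDisp_smul (α c : ℂ) (ψ : FockSpace) : normalDisp α (c • ψ) = c • normalDisp α ψ := by
  rw [normalDisp, map_smul, smul_comm, normalDisp]

theorem normalDisp_add (α : ℂ) (ψ φ : FockSpace) :
    normalDisp α (ψ + φ) = normalDisp α ψ + normalDisp α φ := by
  rw [normalDisp, map_add, smul_add, normalDisp, normalDisp]

theorem chiNormal_proj_smul (c : ℂ) (ψ : FockSpace) (α : ℂ) :
    ‖chiNormal (proj (c • ψ)) α‖ = ‖c‖ ^ 2 * ‖chiNormal (proj ψ) α‖ := by
  rw [chiNormal_proj, chiNormal_proj, normalDisp_smul, inner_smul_left, inner_smul_right, norm_mul,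
    norm_mul, RCLike.norm_conj]
  ring

theorem inner_expVec_normalDisp_expVec (α β γ : ℂ) :
    inner ℂ (expVec β) (normalDisp α (expVec γ)) =
      Complex.exp (conj β * γ + α * conj β - conj α * γ) := by
  rw [inner_expVec_normalDisp, inner_expVec_expVec, ← Complex.exp_add, map_sub]
  congr 1
  ring

/-- Along xα with x real, the two diagonal terms stay constant, while the cross terms are s·e^{−a ±
2xa} up to normalisation. They add with the same sign, so their growth cannot cancel. -/
theorem unboundedChi_cat (s : ℤˣ) {α : ℂ} (hα : α ≠ 0) : UnboundedChi (proj (cat s α)) := by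
  set a : ℝ := ‖α‖ ^ 2 with ha
  have ha0 : 0 < a := by positivity
  have hca : conj α * α = (a : ℂ) := by rw [Complex.conj_mul', ha]; norm_cast
  have hcat : cat s α = ((‖catAux s α‖ : ℂ)⁻¹ * Complex.exp (-(conj α * α) / 2)) •
      (expVec α + ((s : ℤ) : ℂ) • expVec (-α)) := by
    rw [cat, mul_smul, smul_add, smul_comm _ ((s : ℤ) : ℂ)]
    congr 1
    rw [catAux, coherent_eq, coherent_eq, map_neg, neg_mul_neg]
  set κ := ‖(‖catAux s α‖ : ℂ)⁻¹ * Complex.exp (-(conj α * α) / 2)‖ ^ 2 with hκ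
  have hκ0 : 0 < κ := by
    have h1 : (‖catAux s α‖ : ℂ) ≠ 0 := by exact_mod_cast norm_ne_zero_iff.2 (catAux_ne_zero s hα)
    have : (‖catAux s α‖ : ℂ)⁻¹ * Complex.exp (-(conj α * α) / 2) ≠ 0 :=
      mul_ne_zero (inv_ne_zero h1) (Complex.exp_ne_zero _)
    positivity
  have hs : ((s : ℤ) : ℂ) * ((s : ℤ) : ℂ) = 1 := by
    rcases Int.units_eq_one_or s with rfl | rfl <;> simp
  have hsn : ‖((s : ℤ) : ℂ)‖ = 1 := by
    rcases Int.units_eq_one_or s with rfl | rfl <;> simp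
  have key : ∀ x : ℝ, chiNormal (proj (expVec α + ((s : ℤ) : ℂ) • expVec (-α))) (x * α) =
      2 * Real.exp a + ((s : ℤ) : ℂ) * (Real.exp (-a + 2 * x * a) + Real.exp (-a - 2 * x * a) : ℝ) := by
    intro x
    rw [chiNormal_proj, normalDisp_add, normalDisp_smul, inner_add_left, inner_add_right,
      inner_add_right, inner_smul_left, inner_smul_left, inner_smul_right, inner_smul_right]
    simp only [inner_expVec_normalDisp_expVec, map_neg, map_mul, Complex.conj_ofReal, map_intCast]
    have e1 : conj α * α + x * α * conj α - x * conj α * α = (a : ℂ) := by rw [← hca]; ring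
    have e2 : conj α * -α + x * α * conj α - x * conj α * -α = ((-a + 2 * x * a : ℝ) : ℂ) := by
      push_cast; rw [← hca]; ring
    have e3 : -conj α * α + x * α * -conj α - x * conj α * α = ((-a - 2 * x * a : ℝ) : ℂ) := by
      push_cast; rw [← hca]; ring
    have e4 : -conj α * -α + x * α * -conj α - x * conj α * -α = (a : ℂ) := by rw [← hca]; ring
    rw [e1, e2, e3, e4, ← Complex.ofReal_exp, ← Complex.ofReal_exp, ← Complex.ofReal_exp,
      Complex.ofReal_add]
    linear_combination (Real.exp a : ℂ) * hs
  refine unboundedChi_of_tendsto (f := fun x : ℝ => x * α)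
    (g := fun x => κ * (Real.exp (-a + 2 * x * a) - 2 * Real.exp a)) ?_ fun x => ?_
  · refine Tendsto.const_mul_atTop hκ0 (tendsto_atTop_add_const_right _ _
      (Real.tendsto_exp_atTop.comp (tendsto_atTop_add_const_left _ _ ?_)))
    exact (tendsto_id.const_mul_atTop two_pos).atTop_mul_const ha0
  · rw [hcat, chiNormal_proj_smul, ← hκ, key]
    gcongr
    have h1 : Real.exp (-a + 2 * x * a) + Real.exp (-a - 2 * x * a) =
        ‖((s : ℤ) : ℂ) * (Real.exp (-a + 2 * x * a) + Real.exp (-a - 2 * x * a) : ℝ)‖ := by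
      rw [norm_mul, hsn, Complex.norm_real, Real.norm_of_nonneg (by positivity), one_mul]
    have h2 : ‖(2 * Real.exp a : ℂ)‖ = 2 * Real.exp a := by
      rw [norm_mul, Complex.norm_real, Real.norm_of_nonneg (by positivity)]; norm_num
    have h3 := norm_sub_le
      (2 * Real.exp a + ((s : ℤ) : ℂ) *
        (Real.exp (-a + 2 * x * a) + Real.exp (-a - 2 * x * a) : ℝ)) (2 * Real.exp a : ℂ)
    rw [add_sub_cancel_left, ← h1, h2] at h3
    have := Real.exp_pos (-a - 2 * x * a)
    linarith

/-! ### Squeezed states -/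

theorem bargmann_sqVec {z : ℂ} (hz : ‖z‖ < 1) (w : ℂ) :
    bargmann (sqVec z) w = Complex.exp (z * w ^ 2 / 2) := by
  have h := (hasSum_sqVec hz).mapL (innerSL ℂ (expVec (conj w)))
  refine h.unique ?_
  have h' := NormedSpace.expSeries_div_hasSum_exp (z * w ^ 2 / 2)
  rw [← Complex.exp_eq_exp_ℂ] at h'
  convert h' using 2 with k
  rw [innerSL_apply_apply, inner_smul_right, inner_smul_right, inner_fock_right, expVec_apply]
  simp only [map_div₀, map_pow, Complex.conj_ofReal, Complex.conj_conj]
  rw [sqCoeff]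
  have h0 := sqrt_factorial_ne_zero (2 * k)
  have h1 : (k.factorial : ℂ) ≠ 0 := by exact_mod_cast k.factorial_ne_zero
  push_cast
  rw [div_pow, mul_pow, pow_mul]
  field_simp

/-- The displaced Bargmann function is e^{q/2} e^{bw} e^{zw²/2} with b = α − zα*. When zb² ≥ 0 every
Fock contribution to χ₁ is nonnegative, so the vacuum term e^{q/2} is already a lower bound and no
closed form is needed. -/
theorem norm_chiNormal_sqVec_ge {z q d : ℝ} (hz : |z| < 1) {α : ℂ}
    (hq : (z : ℂ) * (conj α) ^ 2 = q) (hd : (z : ℂ) * (α - z * conj α) ^ 2 = d) (hd0 : 0 ≤ d) :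
    Real.exp (q / 2) ≤ ‖chiNormal (proj (sqVec z)) α‖ := by
  have hz' : ‖(z : ℂ)‖ < 1 := by rwa [Complex.norm_real]
  set b := α - z * conj α with hb
  set S := sqVec (z : ℂ) with hS
  have hcoef : ∀ n, normalDisp α S n = (Real.sqrt (n.factorial : ℝ) : ℂ) *
      (Complex.exp (q / 2) * ∑ p ∈ Finset.HasAntidiagonal.antidiagonal n,
        (S p.1 / (Real.sqrt (p.1.factorial : ℝ) : ℂ)) * (b ^ p.2 / (p.2.factorial : ℂ))) := by
    refine apply_eq_of_bargmann fun w => ?_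
    rw [bargmann_normalDisp, hS, bargmann_sqVec hz']
    have h := (hasSum_cauchy_mul (hasSum_bargmann S w) (hasSum_exp_mul b w)).mul_left
      (Complex.exp (q / 2))
    rw [hS, bargmann_sqVec hz', ← Complex.exp_add, ← Complex.exp_add] at h
    refine hasSum_of_eq h (fun n => by ring) ?_
    rw [← Complex.exp_add, ← hq, hb]
    congr 1
    ring
  have hterm : ∀ n, ∃ r : ℝ, 0 ≤ r ∧ (n = 0 → r = 1) ∧
      inner ℂ S (fock n) * inner ℂ (fock n) (normalDisp α S) = (Real.exp (q / 2) : ℂ) * r := by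
    intro n
    rw [inner_fock_right, inner_fock_left, hcoef]
    obtain ⟨k, rfl | rfl⟩ := Nat.even_or_odd' n
    · have hin : ∀ p ∈ Finset.HasAntidiagonal.antidiagonal (2 * k), ∃ r : ℝ, 0 ≤ r ∧ (z : ℂ) ^ k *
          ((S p.1 / (Real.sqrt (p.1.factorial : ℝ) : ℂ)) * (b ^ p.2 / (p.2.factorial : ℂ))) = r := by
        intro p hp
        have hp' := Finset.HasAntidiagonal.mem_antidiagonal.1 hp
        obtain ⟨l, hl | hl⟩ := Nat.even_or_odd' p.1
        · obtain ⟨j, hj⟩ : ∃ j, p.2 = 2 * j := ⟨k - l, by omega⟩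
          have hk : k = l + j := by omega
          -- Since k = l + j, the factors zᵏ · zˡ · b^{2j} regroup as z^{2l} (zb²)ʲ, with zb² = d.
          refine ⟨z ^ (2 * l) * d ^ j * (sqCoeff l / Real.sqrt ((2 * l).factorial : ℝ) /
            ((2 * j).factorial : ℝ)), ?_, ?_⟩
          · have := sqCoeff_pos l
            have : 0 ≤ z ^ (2 * l) := by rw [pow_mul]; positivity
            positivity
          · rw [hl, hj, hk, hS, sqVec_even hz']
            push_cast
            rw [← hd]
            ring_nf
        · refine ⟨0, le_rfl, ?_⟩
          rw [hl, hS, sqVec_odd hz']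
          simp
      choose! f hf0 hf using hin
      refine ⟨sqCoeff k * Real.sqrt ((2 * k).factorial : ℝ) *
        ∑ p ∈ Finset.HasAntidiagonal.antidiagonal (2 * k), f p, ?_, ?_, ?_⟩
      · have := sqCoeff_pos k
        have := Finset.sum_nonneg hf0
        positivity
      · intro h0
        obtain rfl : k = 0 := by omega
        have := hf (0, 0) (by simp)
        have h00 : S 0 = 1 := by simpa [sqCoeff] using sqVec_even hz' 0
        simp only [pow_zero, Nat.factorial_zero, h00, Nat.cast_one, Real.sqrt_one,
          Complex.ofReal_one, div_one, mul_one] at this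
        have h1 : f (0, 0) = 1 := by exact_mod_cast this.symm
        simp [sqCoeff, h1]
      · rw [hS, sqVec_even hz', ← hS, Complex.ofReal_mul, Complex.ofReal_sum,
          ← Finset.sum_congr rfl hf, ← Finset.mul_sum]
        simp only [map_mul, map_pow, Complex.conj_ofReal]
        push_cast
        ring
    · refine ⟨0, le_rfl, by omega, ?_⟩
      rw [hS, sqVec_odd hz']
      simp
  choose r hr0 hr1 hr using hterm
  have hsum := hasSum_inner_fock S (normalDisp α S)
  simp_rw [hr] at hsum
  rw [← chiNormal_proj] at hsum
  have hre := hsum.mapL Complex.reCLM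
  have e : (fun n => Complex.reCLM ((Real.exp (q / 2) : ℂ) * r n)) =
      fun n => Real.exp (q / 2) * r n := by
    funext n
    rw [← Complex.ofReal_mul, Complex.reCLM_apply, Complex.ofReal_re]
  rw [e] at hre
  have h0 := le_hasSum hre 0 fun n _ => mul_nonneg (Real.exp_pos _).le (hr0 n)
  rw [hr1 0 rfl, mul_one] at h0
  exact h0.trans (Complex.re_le_norm _)

/-- The line is the axis on which zα*² = |z|x²: imaginary for z < 0, real for z > 0. There zb² =
|z|(1 − |z|)²x² is nonnegative as well. -/
theorem unboundedChi_squeezed {r : ℝ} (hr : r ≠ 0) : UnboundedChi (proj (squeezed r)) := by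
  rw [squeezed_eq, squeezedOrbit, mul_one]
  set z : ℝ := -Real.tanh r with hz
  have hz1 : |z| < 1 := by rw [hz, abs_neg]; exact Real.abs_tanh_lt_one r
  have hz0 : z ≠ 0 := by
    rw [hz, neg_ne_zero, Real.tanh_eq_sinh_div_cosh]
    exact div_ne_zero (by simpa using hr) (Real.cosh_pos r).ne'
  have hc := Real.sqrt_pos.2 (Real.cosh_pos r)
  set c : ℝ := (Real.sqrt (Real.cosh r))⁻¹
  have hc0 : 0 < c := inv_pos.2 hc
  have hT : Tendsto (fun x : ℝ => ‖(c : ℂ)‖ ^ 2 * Real.exp (|z| * x ^ 2 / 2)) atTop atTop := by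
    have : 0 < ‖(c : ℂ)‖ ^ 2 := by
      rw [Complex.norm_real, Real.norm_of_nonneg hc0.le]; positivity
    refine Tendsto.const_mul_atTop this (Real.tendsto_exp_atTop.comp ?_)
    exact ((tendsto_pow_atTop two_ne_zero).const_mul_atTop (abs_pos.2 hz0)).atTop_div_const two_pos
  rcases lt_or_gt_of_ne hz0 with h | h
  · refine unboundedChi_of_tendsto (f := fun x : ℝ => x * Complex.I) hT fun x => ?_
    rw [chiNormal_proj_smul]
    gcongr
    refine norm_chiNormal_sqVec_ge hz1 (d := -z * (1 + z) ^ 2 * x ^ 2) ?_ ?_ ?_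
    · rw [map_mul, Complex.conj_ofReal, Complex.conj_I, abs_of_neg h]
      push_cast
      linear_combination (z * x ^ 2 : ℂ) * Complex.I_sq
    · rw [map_mul, Complex.conj_ofReal, Complex.conj_I]
      push_cast
      linear_combination (z * (1 + z) ^ 2 * x ^ 2 : ℂ) * Complex.I_sq
    · have : 0 < -z := by linarith
      positivity
  · refine unboundedChi_of_tendsto (f := fun x : ℝ => x) hT fun x => ?_
    rw [chiNormal_proj_smul]
    gcongr
    refine norm_chiNormal_sqVec_ge hz1 (d := z * (1 - z) ^ 2 * x ^ 2) ?_ ?_ ?_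
    · rw [Complex.conj_ofReal, abs_of_pos h]
      push_cast
      ring
    · rw [Complex.conj_ofReal]
      push_cast
      ring
    · positivity

/-! ### Gaussian integrals over the complex plane -/

/-- The Gaussian `exp (-b |α|² + u α + v α*)`. -/
def gaussFun (b : ℝ) (u v α : ℂ) : ℂ := Complex.exp (-b * (conj α * α) + u * α + v * conj α)

theorem gaussFun_eq_mul (b : ℝ) (u v : ℂ) (p : ℝ × ℝ) :
    gaussFun b u v (Complex.measurableEquivRealProd.symm p) =
      Complex.exp (-b * (p.1 : ℂ) ^ 2 + (u + v) * p.1 + 0) *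
        Complex.exp (-b * (p.2 : ℂ) ^ 2 + (Complex.I * (u - v)) * p.2 + 0) := by
  have h : Complex.measurableEquivRealProd.symm p = p.1 + p.2 * Complex.I := by
    rw [Complex.measurableEquivRealProd_symm_apply, Complex.mk_eq_add_mul_I]
  rw [gaussFun, h, ← Complex.exp_add]
  congr 1
  simp only [map_add, map_mul, Complex.conj_ofReal, Complex.conj_I]
  linear_combination ((b : ℂ) * p.2 ^ 2) * Complex.I_sq

theorem measurePreserving_equivRealProd_symm :
    MeasurePreserving Complex.measurableEquivRealProd.symm
      ((volume : Measure ℝ).prod (volume : Measure ℝ)) (volume : Measure ℂ) :=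
  Complex.volume_preserving_equiv_real_prod.symm

theorem integrable_gaussFun {b : ℝ} (hb : 0 < b) (u v : ℂ) : Integrable (gaussFun b u v) := by
  rw [← measurePreserving_equivRealProd_symm.integrable_comp_emb
    (MeasurableEquiv.measurableEmbedding _)]
  have h := fun c => integrable_cexp_quadratic (b := (b : ℂ)) (by simpa using hb) c 0
  refine ((h (u + v)).mul_prod (h (Complex.I * (u - v)))).congr (Eventually.of_forall fun p => ?_)
  exact (gaussFun_eq_mul b u v p).symm

theorem integral_gaussFun (u v : ℂ) :
    ∫ α, gaussFun 1 u v α = Real.pi * Complex.exp (u * v) := by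
  rw [← measurePreserving_equivRealProd_symm.integral_comp
    (MeasurableEquiv.measurableEmbedding _)]
  simp_rw [gaussFun_eq_mul]
  rw [integral_prod_mul (fun x : ℝ => Complex.exp (-(1 : ℝ) * (x : ℂ) ^ 2 + (u + v) * x + 0))
    (fun x : ℝ => Complex.exp (-(1 : ℝ) * (x : ℂ) ^ 2 + (Complex.I * (u - v)) * x + 0)),
    integral_cexp_quadratic (by simp), integral_cexp_quadratic (by simp)]
  rw [mul_mul_mul_comm, ← Complex.exp_add]
  congr 1
  · have hpi : ((Real.pi : ℂ) / - -((1 : ℝ) : ℂ)) = (Real.pi : ℂ) := by simp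
    rw [hpi, ← Complex.cpow_add _ _ (by exact_mod_cast Real.pi_ne_zero)]
    norm_num
  · congr 1
    push_cast
    linear_combination ((u - v) ^ 2 / 4) * Complex.I_sq

/-! ### Strong continuity of the displacement operators -/

theorem continuous_expVec : Continuous expVec := continuous_iff_continuousAt.2 fun β => by
  obtain ⟨v, hv, -⟩ := exists_hasDerivAt_expVec β
  exact hv.continuousAt

/-- Clear from the explicit formula on exponential vectors; as all D(α) are isometries,
approximation from their dense span is uniform in α. -/
theorem continuous_displacement_apply (x : FockSpace) : Continuous fun α => displacement α x := by
  have hspan : ∀ y ∈ Submodule.span ℂ (Set.range expVec), Continuous fun α => displacement α y := by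
    intro y hy
    induction hy using Submodule.span_induction with
    | mem y hy =>
      obtain ⟨γ, rfl⟩ := hy
      simp_rw [displacement_expVec]
      have := continuous_expVec
      have := Complex.continuous_conj
      fun_prop
    | zero => simpa using continuous_const
    | add y z _ _ hy hz => simp_rw [map_add]; exact hy.add hz
    | smul c y _ hy => simp_rw [map_smul]; exact hy.const_smul c
  refine continuous_of_uniform_approx_of_continuous fun u hu => ?_
  obtain ⟨ε, hε, hu⟩ := Metric.mem_uniformity_dist.1 hu
  obtain ⟨y, hy, hxy⟩ := Metric.mem_closure_iff.1 (dense_span_expVec x) ε hε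
  refine ⟨fun α => displacement α y, hspan y hy, fun α => hu ?_⟩
  rwa [dist_eq_norm, ← map_sub, norm_displacement_apply, ← dist_eq_norm]

/-! ### Inversion of the characteristic function -/

/-- The kernel of the inversion formula for the matrix element `⟨E γ, T E β⟩`. -/
def inversionKernel (β γ α : ℂ) : ℂ :=
  Complex.exp (conj γ * β) * gaussFun (1 / 2) (-conj γ) β α

theorem integrable_inversionKernel (β γ : ℂ) : Integrable (inversionKernel β γ) :=
  (integrable_gaussFun (by norm_num) _ _).const_mul _

theorem integrable_kernel_smul (β γ : ℂ) (x : FockSpace) :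
    Integrable fun α => inversionKernel β γ α • displacement α x := by
  have hc : Continuous (inversionKernel β γ) := by
    unfold inversionKernel gaussFun
    have := Complex.continuous_conj
    fun_prop
  refine ((integrable_inversionKernel β γ).norm.mul_const ‖x‖).mono'
    (hc.smul (continuous_displacement_apply x)).aestronglyMeasurable
    (Eventually.of_forall fun α => ?_)
  rw [norm_smul, norm_displacement_apply]

/-- Both sides are bounded linear in x, so it suffices to test between exponential vectors. There
the half Gaussian of the kernel and that of D(α) combine to e^{−|α|²}, and the integral is
elementary. -/
theorem integral_kernel_smul (β γ : ℂ) (x : FockSpace) :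
    ∫ α, inversionKernel β γ α • displacement α x =
      ((Real.pi : ℂ) * inner ℂ (expVec γ) x) • expVec β := by
  let J : FockSpace →L[ℂ] FockSpace := LinearMap.mkContinuous
    { toFun := fun x => ∫ α, inversionKernel β γ α • displacement α x
      map_add' := fun x y => by
        rw [← integral_add (integrable_kernel_smul β γ x) (integrable_kernel_smul β γ y)]
        simp_rw [map_add, smul_add]
      map_smul' := fun c x => by
        rw [RingHom.id_apply, ← integral_smul]
        simp_rw [map_smul, smul_comm c] }
    (∫ α, ‖inversionKernel β γ α‖) fun x => by
      refine (norm_integral_le_integral_norm _).trans (le_of_eq ?_)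
      rw [← integral_mul_const]
      simp_rw [norm_smul, norm_displacement_apply]
  have hJ : J = (Real.pi : ℂ) • InnerProductSpace.rankOne ℂ (expVec β) (expVec γ) := by
    refine ContinuousLinearMap.ext_on dense_span_expVec ?_
    rintro _ ⟨ν, rfl⟩
    refine eq_of_inner_expVec fun μ => ?_
    change inner ℂ (expVec μ) (∫ α, inversionKernel β γ α • displacement α (expVec ν)) = _
    rw [← integral_inner (integrable_kernel_smul β γ _)]
    have e : ∀ α, inner ℂ (expVec μ) (inversionKernel β γ α • displacement α (expVec ν)) =
        Complex.exp (conj γ * β + conj μ * ν) * gaussFun 1 (conj μ - conj γ) (β - ν) α := by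
      intro α
      rw [inner_smul_right, inner_expVec_displacement, inversionKernel, gaussFun, gaussFun,
        ← Complex.exp_add, ← Complex.exp_add, ← Complex.exp_add]
      congr 1
      push_cast
      ring
    simp_rw [e]
    rw [integral_const_mul, integral_gaussFun, _root_.smul_apply, inner_smul_right,
      InnerProductSpace.inner_right_rankOne_apply, inner_expVec_expVec, inner_expVec_expVec,
      mul_left_comm, ← Complex.exp_add, ← Complex.exp_add]
    congr 2
    ring
  have := congrArg (fun L : FockSpace →L[ℂ] FockSpace => L x) hJ
  rw [_root_.smul_apply, InnerProductSpace.rankOne_apply, smul_smul] at this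
  exact this

/-- Integrating the kernel against ⟨n|T D(α)|n⟩ and summing over n gives π⟨E(γ), T E(β)⟩. The
partial sums are dominated by the trace norm, so the sum may be taken inside the integral, where it
is χ_T = 0. -/
theorem eq_zero_of_chi_eq_zero {T : Op} (hT : traceNorm T ≠ ⊤) (h : ∀ α, chi T α = 0) : T = 0 := by
  refine ContinuousLinearMap.ext_on dense_span_expVec ?_
  rintro _ ⟨β, rfl⟩
  refine eq_of_inner_expVec fun γ => ?_
  rw [_root_.zero_apply, inner_zero_right]
  have hint : ∀ n, Integrable fun α => inversionKernel β γ α *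
      inner ℂ (fock n) (T (displacement α (fock n))) := by
    intro n
    have := (((innerSL ℂ (fock n)).comp T).integrable_comp (integrable_kernel_smul β γ (fock n)))
    simpa using this
  have hval : ∀ n, ∫ α, inversionKernel β γ α * inner ℂ (fock n) (T (displacement α (fock n))) =
      Real.pi * (inner ℂ (expVec γ) (fock n) * inner ℂ (fock n) (T (expVec β))) := by
    intro n
    have := ((innerSL ℂ (fock n)).comp T).integral_comp_comm
      (integrable_kernel_smul β γ (fock n))
    rw [integral_kernel_smul] at this
    simpa [mul_assoc] using this
  have hlim := tendsto_integral_of_dominated_convergence (μ := volume)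
    (F := fun N α => ∑ n ∈ Finset.range N, inversionKernel β γ α *
      inner ℂ (fock n) (T (displacement α (fock n)))) (f := fun _ => 0)
    (fun α => ‖inversionKernel β γ α‖ * (traceNorm T).toReal)
    (fun N => (integrable_finsetSum _ fun n _ => hint n).aestronglyMeasurable)
    ((integrable_inversionKernel β γ).norm.mul_const _)
    (fun N => Eventually.of_forall fun α => by
      rw [← Finset.mul_sum, norm_mul]
      gcongr
      rw [← ENNReal.ofReal_le_iff_le_toReal hT, ofReal_norm]
      exact (enorm_sum_le _ _).trans (sum_norm_chi_le T α _))
    (Eventually.of_forall fun α => by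
      have := ((hasSum_chi hT α).mul_left (inversionKernel β γ α)).tendsto_sum_nat
      rwa [h α, mul_zero] at this)
  have hsum := ((hasSum_inner_fock (expVec γ) (T (expVec β))).mul_left
    (Real.pi : ℂ)).tendsto_sum_nat
  have e : (fun N => ∫ α, ∑ n ∈ Finset.range N, inversionKernel β γ α *
      inner ℂ (fock n) (T (displacement α (fock n)))) = fun N => ∑ n ∈ Finset.range N,
      (Real.pi : ℂ) * (inner ℂ (expVec γ) (fock n) * inner ℂ (fock n) (T (expVec β))) := by
    funext N
    rw [integral_finsetSum _ fun n _ => hint n]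
    exact Finset.sum_congr rfl fun n _ => hval n
  rw [e, integral_zero] at hlim
  have := tendsto_nhds_unique hsum hlim
  exact (mul_eq_zero.1 this).resolve_left (by exact_mod_cast Real.pi_ne_zero)

/-! ### Mixtures of coherent states -/

theorem continuous_coherent : Continuous coherent := by
  have e : coherent = fun α => Complex.exp (-(conj α * α) / 2) • expVec α := funext coherent_eq
  rw [e]
  have := continuous_expVec
  have := Complex.continuous_conj
  fun_prop

theorem continuous_proj : Continuous proj := by
  refine continuous_iff_continuousAt.2 fun y => tendsto_iff_norm_sub_tendsto_zero.2
    (squeeze_zero (g := fun x => ‖x - y‖ * (‖x‖ + ‖y‖)) (fun _ => norm_nonneg _) (fun x => ?_) ?_)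
  · rw [proj_sub_proj, mul_add]
    refine (norm_add_le _ _).trans ?_
    rw [InnerProductSpace.norm_rankOne, InnerProductSpace.norm_rankOne, mul_comm ‖y‖]
  · have h : Continuous fun x : FockSpace => ‖x - y‖ * (‖x‖ + ‖y‖) := by fun_prop
    simpa using h.tendsto y

theorem norm_proj_coherent (β : ℂ) : ‖proj (coherent β)‖ = 1 := by
  rw [proj, InnerProductSpace.norm_rankOne, norm_coherent, one_mul]

theorem traceNorm_proj_coherent_le (β : ℂ) : traceNorm (proj (coherent β)) ≤ 1 :=
  (traceNorm_rankOne_le _ _).trans (by simp [norm_coherent])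

section Mixture

variable {Ω : Type*} [MeasurableSpace Ω] {μ : Measure Ω}

theorem traceNorm_integral_le {F : Ω → Op} (hF : Integrable F μ) :
    traceNorm (∫ ω, F ω ∂μ) ≤ ∫⁻ ω, traceNorm (F ω) ∂μ := by
  refine traceNorm_le fun N f g hf hg => ?_
  have hL : ∀ i, Integrable (fun ω => inner ℂ (f i) (F ω (g i))) μ := fun i =>
    (hF.apply_continuousLinearMap (g i)).const_inner (f i)
  have h1 : ∀ i, inner ℂ (f i) ((∫ ω, F ω ∂μ) (g i)) = ∫ ω, inner ℂ (f i) (F ω (g i)) ∂μ := by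
    intro i
    rw [ContinuousLinearMap.integral_apply hF,
      integral_inner (hF.apply_continuousLinearMap (g i))]
  calc ∑ i, ‖inner ℂ (f i) ((∫ ω, F ω ∂μ) (g i))‖ₑ
      ≤ ∑ i, ∫⁻ ω, ‖inner ℂ (f i) (F ω (g i))‖ₑ ∂μ := Finset.sum_le_sum fun i _ => by
        rw [h1]; exact enorm_integral_le_lintegral_enorm _
    _ = ∫⁻ ω, ∑ i, ‖inner ℂ (f i) (F ω (g i))‖ₑ ∂μ :=
        (lintegral_finsetSum' _ fun i _ => (hL i).aestronglyMeasurable.enorm).symm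
    _ ≤ _ := lintegral_mono fun ω => sum_le_traceNorm (F ω) hf hg

variable [IsProbabilityMeasure μ]

theorem integrable_proj_coherent {b : Ω → ℂ} (hb : Measurable b) :
    Integrable (fun ω => proj (coherent (b ω))) μ := by
  refine Integrable.of_bound ?_ 1 (Eventually.of_forall fun ω => (norm_proj_coherent _).le)
  exact ((continuous_proj.comp continuous_coherent).stronglyMeasurable.comp_measurable
    hb).aestronglyMeasurable

theorem tendsto_lintegral_coherent_sub {b : Ω → ℂ} {φ : ℕ → Ω → ℂ} (hb : Measurable b)
    (hφm : ∀ k, Measurable (φ k)) (hφ : ∀ ω, Tendsto (fun k => φ k ω) atTop (𝓝 (b ω))) :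
    Tendsto (fun k => ∫⁻ ω, ENNReal.ofReal (‖coherent (b ω) - coherent (φ k ω)‖ * 2) ∂μ) atTop
      (𝓝 0) := by
  have hc : Continuous fun p : ℂ × ℂ => ‖coherent p.1 - coherent p.2‖ * 2 :=
    ((continuous_coherent.comp continuous_fst).sub
      (continuous_coherent.comp continuous_snd)).norm.mul continuous_const
  have h0 : (0 : ℝ≥0∞) = ∫⁻ _, 0 ∂μ := lintegral_zero.symm
  rw [h0]
  refine tendsto_lintegral_of_dominated_convergence (fun _ => ENNReal.ofReal 4) (fun k => ?_)
    (fun k => Eventually.of_forall fun ω => ?_) ?_ (Eventually.of_forall fun ω => ?_)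
  · exact (hc.measurable.comp (hb.prodMk (hφm k))).ennreal_ofReal
  · refine ENNReal.ofReal_le_ofReal ?_
    have := norm_sub_le (coherent (b ω)) (coherent (φ k ω))
    rw [norm_coherent, norm_coherent] at this
    linarith
  · rw [lintegral_const, measure_univ, mul_one]
    exact ENNReal.ofReal_ne_top
  · have h1 : Tendsto (fun k => (b ω, φ k ω)) atTop (𝓝 (b ω, b ω)) :=
      tendsto_const_nhds.prodMk_nhds (hφ ω)
    have h2 := ENNReal.tendsto_ofReal ((hc.tendsto _).comp h1)
    rwa [sub_self, norm_zero, zero_mul, ENNReal.ofReal_zero] at h2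

/-- For a simple function the average lies in the convex hull of finitely many points, which is
closed. Simple approximations of b then converge in trace norm by dominated convergence. -/
theorem mixture_mem_classicalStates {b : Ω → ℂ} (hb : Measurable b) :
    ∫ ω, proj (coherent (b ω)) ∂μ ∈ classicalStates := by
  intro ε hε
  let φ : ℕ → SimpleFunc Ω ℂ := SimpleFunc.approxOn b hb Set.univ 0 (Set.mem_univ 0)
  have hlim := tendsto_lintegral_coherent_sub (μ := μ) (φ := fun k => φ k) hb
    (fun k => (φ k).measurable) fun ω =>
      SimpleFunc.tendsto_approxOn hb (Set.mem_univ 0) (by simp)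
  obtain ⟨k, hk⟩ := (hlim.eventually (gt_mem_nhds hε)).exists
  have hint := integrable_proj_coherent (μ := μ) hb
  have hint' := integrable_proj_coherent (μ := μ) (φ k).measurable
  refine ⟨∫ ω, proj (coherent (φ k ω)) ∂μ, ?_, ?_⟩
  · have hfin : (Set.range fun ω => proj (coherent (φ k ω))).Finite := by
      have := (φ k).finite_range.image fun β => proj (coherent β)
      rwa [← Set.range_comp] at this
    refine convexHull_mono ?_ ((convex_convexHull ℝ _).integral_mem
      (hfin.isClosed_convexHull ℝ) (Eventually.of_forall fun ω =>
        subset_convexHull ℝ _ ⟨ω, rfl⟩) hint')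
    rintro _ ⟨ω, rfl⟩
    exact ⟨φ k ω, rfl⟩
  · rw [← integral_sub hint hint']
    refine (traceNorm_integral_le (hint.sub hint')).trans_lt (lt_of_le_of_lt ?_ hk)
    refine lintegral_mono fun ω => (traceNorm_proj_sub_le _ _).trans (le_of_eq ?_)
    rw [norm_coherent, norm_coherent]
    norm_num

theorem chi_mixture {b : Ω → ℂ} (hb : Measurable b) (α : ℂ) :
    chi (∫ ω, proj (coherent (b ω)) ∂μ) α = ∫ ω, chi (proj (coherent (b ω))) α ∂μ := by
  have hint := integrable_proj_coherent (μ := μ) hb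
  have hsum := (hasSum_chi (traceNorm_classical_ne_top
    (mixture_mem_classicalStates (μ := μ) hb)) α).tendsto_sum_nat
  have hi : ∀ n, Integrable (fun ω =>
      inner ℂ (fock n) (proj (coherent (b ω)) (displacement α (fock n)))) μ := fun n =>
    (hint.apply_continuousLinearMap _).const_inner (fock n)
  have e : ∀ N, ∑ n ∈ Finset.range N, inner ℂ (fock n)
      ((∫ ω, proj (coherent (b ω)) ∂μ) (displacement α (fock n))) = ∫ ω, ∑ n ∈ Finset.range N,
      inner ℂ (fock n) (proj (coherent (b ω)) (displacement α (fock n))) ∂μ := by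
    intro N
    rw [integral_finsetSum _ fun n _ => hi n]
    refine Finset.sum_congr rfl fun n _ => ?_
    rw [ContinuousLinearMap.integral_apply hint, integral_inner (hint.apply_continuousLinearMap _)]
  simp_rw [e] at hsum
  have hne : ∀ ω, traceNorm (proj (coherent (b ω))) ≠ ⊤ := fun ω =>
    ((traceNorm_proj_coherent_le _).trans_lt ENNReal.one_lt_top).ne
  refine tendsto_nhds_unique hsum (tendsto_integral_of_dominated_convergence (fun _ => 1)
    (fun N => (integrable_finsetSum _ fun n _ => hi n).aestronglyMeasurable)
    (integrable_const _) (fun N => Eventually.of_forall fun ω => ?_)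
    (Eventually.of_forall fun ω => (hasSum_chi (hne ω) α).tendsto_sum_nat))
  have := (enorm_sum_le _ _).trans ((sum_norm_chi_le (proj (coherent (b ω))) α
    (Finset.range N)).trans (traceNorm_proj_coherent_le _))
  rw [← ofReal_norm] at this
  exact ENNReal.ofReal_le_one.1 this

end Mixture

/-! ### Gaussian states -/

/-- The two-dimensional standard normal distribution. -/
def stdNormal : Measure (ℝ × ℝ) := (gaussianReal 0 1).prod (gaussianReal 0 1)

instance : IsProbabilityMeasure stdNormal := by unfold stdNormal; infer_instance

theorem integral_exp_gaussianReal (t : ℝ) :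
    ∫ x : ℝ, Complex.exp (t * x * Complex.I) ∂(gaussianReal 0 1) = Complex.exp (-t ^ 2 / 2) := by
  rw [← charFun_apply_real, charFun_gaussianReal]
  congr 1
  simp
  ring

/-- The phase-space point `β` with `2 Im (α β*) = p Re α + q Im α`. -/
def dualPoint (p q : ℝ) : ℂ := ⟨q / 2, -p / 2⟩

theorem mul_conj_dualPoint (p q : ℝ) (α : ℂ) :
    α * conj (dualPoint p q) - conj α * dualPoint p q = (p * α.re + q * α.im : ℝ) * Complex.I := by
  apply Complex.ext
  · simp [dualPoint]
  · simp [dualPoint]; ring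

/-- The coherent amplitude is β₀ + Xβ₁ + Yβ₂ with X, Y independent standard normals. Each coherent
state contributes the phase e^{i(l₀ + X l₁ + Y l₂)}, whose mean is e^{i l₀ − (l₁² + l₂²)/2}. -/
theorem exists_classical_gaussian (p₀ q₀ p₁ q₁ p₂ q₂ : ℝ) : ∃ τ ∈ classicalStates, ∀ α : ℂ,
    chi τ α = Complex.exp (-(conj α * α) / 2) * Complex.exp (Complex.I * (p₀ * α.re + q₀ * α.im : ℝ) -
      ((p₁ * α.re + q₁ * α.im) ^ 2 + (p₂ * α.re + q₂ * α.im) ^ 2 : ℝ) / 2) := by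
  set b : ℝ × ℝ → ℂ := fun ω => dualPoint p₀ q₀ + ω.1 * dualPoint p₁ q₁ + ω.2 * dualPoint p₂ q₂
    with hb
  have hbm : Measurable b := by
    rw [hb]; fun_prop
  refine ⟨_, mixture_mem_classicalStates (μ := stdNormal) hbm, fun α => ?_⟩
  rw [chi_mixture hbm]
  set l₀ : ℝ := p₀ * α.re + q₀ * α.im
  set l₁ : ℝ := p₁ * α.re + q₁ * α.im
  set l₂ : ℝ := p₂ * α.re + q₂ * α.im
  have e : ∀ ω, chi (proj (coherent (b ω))) α = (Complex.exp (-(conj α * α) / 2) *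
      Complex.exp (Complex.I * l₀)) *
      (Complex.exp (l₁ * ω.1 * Complex.I) * Complex.exp (l₂ * ω.2 * Complex.I)) := by
    intro ω
    rw [chi_coherent, mul_assoc, ← Complex.exp_add (l₁ * ω.1 * Complex.I),
      ← Complex.exp_add (Complex.I * l₀)]
    congr 2
    have h0 := mul_conj_dualPoint p₀ q₀ α
    have h1 := mul_conj_dualPoint p₁ q₁ α
    have h2 := mul_conj_dualPoint p₂ q₂ α
    simp only [hb, map_add, map_mul, Complex.conj_ofReal]
    linear_combination h0 + (ω.1 : ℂ) * h1 + (ω.2 : ℂ) * h2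
  simp_rw [e]
  rw [integral_const_mul, stdNormal, integral_prod_mul
    (fun x : ℝ => Complex.exp (l₁ * x * Complex.I)) (fun x : ℝ => Complex.exp (l₂ * x * Complex.I)),
    integral_exp_gaussianReal, integral_exp_gaussianReal, mul_assoc, ← Complex.exp_add,
    ← Complex.exp_add]
  congr 2
  push_cast
  ring

/-- Completing the square; in the degenerate case A = 0 nonnegativity forces B = 0. -/
theorem exists_sum_sq_of_nonneg {A B C : ℝ} (h : ∀ x y : ℝ, 0 ≤ A * x ^ 2 + 2 * B * x * y + C * y ^ 2) :
    ∃ p₁ q₁ q₂ : ℝ, ∀ x y : ℝ,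
      A * x ^ 2 + 2 * B * x * y + C * y ^ 2 = (p₁ * x + q₁ * y) ^ 2 + (0 * x + q₂ * y) ^ 2 := by
  have hA : 0 ≤ A := by simpa using h 1 0
  have hC : 0 ≤ C := by simpa using h 0 1
  rcases hA.eq_or_lt with rfl | hA
  · have hB : B = 0 := by
      by_contra hB
      -- At this point the form would take the value −1.
      have := h (-(C + 1) / (2 * B)) 1
      have e : 2 * B * (-(C + 1) / (2 * B)) = -(C + 1) := by field_simp
      rw [e] at this
      linarith
    refine ⟨0, 0, Real.sqrt C, fun x y => ?_⟩
    have := Real.sq_sqrt hC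
    rw [hB]
    linear_combination (-y ^ 2) * this
  · have hD : 0 ≤ C - B ^ 2 / A := by
      have := h (-B / A) 1
      have e : A * (-B / A) ^ 2 + 2 * B * (-B / A) * 1 + C * 1 ^ 2 = C - B ^ 2 / A := by
        field_simp; ring
      rwa [e] at this
    have hs := Real.sq_sqrt hA.le
    have hs0 := (Real.sqrt_pos.2 hA).ne'
    refine ⟨Real.sqrt A, B / Real.sqrt A, Real.sqrt (C - B ^ 2 / A), fun x y => ?_⟩
    have h1 := Real.sq_sqrt hD
    have h2 : Real.sqrt A * (B / Real.sqrt A) = B := by field_simp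
    have h3 : (B / Real.sqrt A) ^ 2 = B ^ 2 / A := by rw [div_pow, hs]
    linear_combination (-x ^ 2) * hs - (2 * x * y) * h2 - y ^ 2 * h3 - y ^ 2 * h1

/-- The exponent is homogeneous of degree 2, so one direction with positive value makes it blow up
along the ray. -/
theorem norm_sq_le_of_bounded {Q : QuadraticForm ℝ ℂ} {C : ℝ}
    (h : ∀ α : ℂ, Real.exp (‖α‖ ^ 2 / 2 - Q α / 2) ≤ C) (α : ℂ) : ‖α‖ ^ 2 ≤ Q α := by
  by_contra! hlt
  have hd : 0 < ‖α‖ ^ 2 - Q α := by linarith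
  have hT : Tendsto (fun t : ℝ => Real.exp (t ^ 2 * ((‖α‖ ^ 2 - Q α) / 2))) atTop atTop :=
    Real.tendsto_exp_atTop.comp ((tendsto_pow_atTop two_ne_zero).atTop_mul_const (by positivity))
  obtain ⟨t, ht⟩ := (hT.eventually_gt_atTop C).exists
  have h1 := h (t • α)
  rw [QuadraticMap.map_smul, norm_smul, Real.norm_eq_abs, mul_pow, sq_abs, smul_eq_mul] at h1
  have e : t ^ 2 * ‖α‖ ^ 2 / 2 - t * t * Q α / 2 = t ^ 2 * ((‖α‖ ^ 2 - Q α) / 2) := by ring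
  rw [e] at h1
  linarith

theorem quadraticForm_complex_apply (Q : QuadraticForm ℝ ℂ) (α : ℂ) : Q α =
    Q 1 * α.re ^ 2 + QuadraticMap.polar Q 1 Complex.I * α.re * α.im + Q Complex.I * α.im ^ 2 := by
  have h : α = α.re • (1 : ℂ) + α.im • Complex.I := by
    rw [Complex.real_smul, Complex.real_smul, mul_one, Complex.re_add_im]
  conv_lhs => rw [h]
  rw [QuadraticMap.map_add Q, QuadraticMap.map_smul, QuadraticMap.map_smul,
    QuadraticMap.polar_smul_left, QuadraticMap.polar_smul_right]
  simp only [smul_eq_mul]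
  ring

theorem linearMap_complex_apply (m : ℂ →ₗ[ℝ] ℝ) (α : ℂ) :
    m α = m 1 * α.re + m Complex.I * α.im := by
  have h : α = α.re • (1 : ℂ) + α.im • Complex.I := by
    rw [Complex.real_smul, Complex.real_smul, mul_one, Complex.re_add_im]
  conv_lhs => rw [h]
  rw [map_add, map_smul, map_smul, smul_eq_mul, smul_eq_mul]
  ring

theorem unboundedChi_gaussian {ρ : Op} (hρ : IsGaussian ρ) (hn : ρ ∉ classicalStates) :
    UnboundedChi ρ := by
  obtain ⟨hd, m, Q, hQ⟩ := hρ
  rintro ⟨C, hC⟩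
  have hle := norm_sq_le_of_bounded (Q := Q) (C := C) fun α => by
    have := hC ⟨α, rfl⟩
    dsimp only at this
    rw [norm_chiNormal, hQ, Complex.norm_exp, ← Real.exp_add] at this
    convert this using 2
    simp
    ring
  -- The form decomposed is Q(α) − |α|²; the subtracted part is the vacuum noise that every coherent
  -- state already carries.
  obtain ⟨p₁, q₁, q₂, hpq⟩ := exists_sum_sq_of_nonneg (A := Q 1 - 1)
    (B := QuadraticMap.polar Q 1 Complex.I / 2) (C := Q Complex.I - 1) fun x y => by
      have := hle ⟨x, y⟩
      rw [quadraticForm_complex_apply, Complex.sq_norm, Complex.normSq_mk] at this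
      dsimp only at this
      linarith
  obtain ⟨τ, hτ, hchi⟩ := exists_classical_gaussian (m 1) (m Complex.I) p₁ q₁ 0 q₂
  have hρt : traceNorm ρ ≠ ⊤ := ((traceNorm_density_le hd).trans_lt ENNReal.one_lt_top).ne
  have hτt := traceNorm_classical_ne_top hτ
  refine hn ?_
  have : ρ - τ = 0 := eq_zero_of_chi_eq_zero (traceNorm_sub_ne_top hρt hτt) fun α => by
    rw [chi_sub hρt hτt, hQ, hchi, ← hpq, ← Complex.exp_add, sub_eq_zero]
    congr 1
    rw [quadraticForm_complex_apply, linearMap_complex_apply m, Complex.conj_mul', ← Complex.ofReal_pow,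
      Complex.sq_norm, Complex.normSq_apply]
    push_cast
    ring
  rwa [sub_eq_zero.1 this]

end

end BosonicMode

theorem mainTheorem8 :
    -- the exponentials and the traces in the statement are well defined
    (∀ α : ℂ, ∃! D : Op, IsExpOp (displacementGenerator α) D) ∧
    (∀ r : ℝ, ∃! ζ : FockSpace, IsExpVec (squeezingGenerator r) (fock 0) ζ) ∧
    (∀ ρ : Op, IsDensity ρ → ∀ α : ℂ,
      Summable fun n => (inner ℂ (fock n) ((ρ ∘L displacement α) (fock n)) : ℂ)) ∧
    -- the lower bound
    (∀ ρ : Op, IsDensity ρ →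
      ((⨆ α : ℂ, ‖chiNormal ρ α‖ₑ) + 1) / 2 ≤ nonclassicalityRobustness ρ) ∧
    -- states with unbounded characteristic function
    (∀ ρ : Op, IsDensity ρ → UnboundedChi ρ → nonclassicalityRobustness ρ = ⊤) ∧
    -- finite superpositions of Fock states other than the vacuum
    (∀ ψ : FockSpace, ψ ∈ Submodule.span ℂ (Set.range fock) → ‖ψ‖ = 1 → (∃ n : ℕ, 1 ≤ n ∧ ψ n ≠ 0) →
      IsDensity (proj ψ) ∧ UnboundedChi (proj ψ) ∧ nonclassicalityRobustness (proj ψ) = ⊤) ∧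
    -- squeezed states
    (∀ r : ℝ, r ≠ 0 →
      IsDensity (proj (squeezed r)) ∧ UnboundedChi (proj (squeezed r)) ∧
        nonclassicalityRobustness (proj (squeezed r)) = ⊤) ∧
    -- even and odd cat states
    (∀ (s : ℤˣ) (α : ℂ), α ≠ 0 →
      IsDensity (proj (cat s α)) ∧ UnboundedChi (proj (cat s α)) ∧
        nonclassicalityRobustness (proj (cat s α)) = ⊤) ∧
    -- nonclassical Gaussian states
    (∀ ρ : Op, IsGaussian ρ → ρ ∉ classicalStates →
      UnboundedChi ρ ∧ nonclassicalityRobustness ρ = ⊤) := by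
  refine ⟨fun α => ⟨_, isExpOp_displacementIsometry α, fun D hD =>
      isExpOp_displacement_unique hD (isExpOp_displacementIsometry α)⟩,
    fun r => ⟨_, (isExpVec_squeezed_iff r _).2 rfl, fun ζ => (isExpVec_squeezed_iff r ζ).1⟩,
    fun ρ hρ α => ?_, fun ρ hρ => robustness_lower_bound hρ, fun ρ hρ h => robustness_eq_top hρ h,
    fun ψ hψ hn h1 => ?_, fun r hr => ?_, fun s α hα => ?_, fun ρ hρ hn => ?_⟩
  · exact (hasSum_chi ((traceNorm_density_le hρ).trans_lt ENNReal.one_lt_top).ne α).summable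
  · obtain ⟨N, hN, hψN, hψ0⟩ := exists_top_coeff hψ h1
    exact isDensity_and_robustness hn (unboundedChi_finite hN hψN hψ0)
  · exact isDensity_and_robustness (by rw [squeezed_eq, norm_squeezedOrbit])
      (unboundedChi_squeezed hr)
  · exact isDensity_and_robustness (norm_cat s hα) (unboundedChi_cat s hα)
  · exact ⟨unboundedChi_gaussian hρ hn, robustness_eq_top hρ.1 (unboundedChi_gaussian hρ hn)⟩
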